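/- Consider $\min_{x\in\mathcal X}\max_{y\in\mathcal Y}\mathcal L(x,y)$, where $\mathcal X\subset\mathbb R^{n_x}$ and $\mathcal Y\subset\mathbb R^{n_y}$ are compact convex sets, $\mathcal L$ is continuously differentiable on an open set containing $\mathcal X\times\mathcal Y$ and convex-concave over $\mathcal X\times\mathcal Y$, and $\mathcal L(x,\cdot)$ is $\mu$-strongly concave on $\mathcal Y$ for every $x\in\mathcal X$, with $\mu\ge 0$. Assume that there are $L_{xx},L_{yy}\ge 0$ and $L_{yx}>0$ such that for all $(x,y),(x',y')\in\mathcal X\times\mathcal Y$ $$\|\nabla_x\mathcal L(x,y)-\nabla_x\mathcal L(x',y')\|\le L_{xx}\|x-x'\|+L_{yx}\|y-y'\|,\qquad \|\nabla_y\mathcal L(x,y)-\nabla_y\mathcal L(x',y')\|\le L_{yx}\|x-x'\|+L_{yy}\|y-y'\|.$$ Let $f(x)=\max_{y\in\mathcal Y}\mathcal L(x,y)$, $G_{\mathcal X}^{\mathrm{opt}}(x)=f(x)-\min_{v\in\mathcal X}f(v)$ and $G_{\mathcal Y}(x,y)=f(x)-\mathcal L(x,y)$. Given stepsizes $\tau_t>0$,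 smoothing parameters $\beta_t\ge 0$ and a starting point $(x_0,y_0)\in\mathcal X\times\mathcal Y$, put $\mathcal L_\beta(x,y)=\mathcal L(x,y)-\frac{\beta}{2}\|y-y_0\|^2$ and, for $t\ge 0$, let $$x_{t+1}=\operatorname*{argmin}_{v\in\mathcal X}\|x_t-\tau_t\nabla_x\mathcal L(x_t,y_t)-v\|^2,\qquad u_t\in\operatorname*{argmax}_{u\in\mathcal Y}\nabla_y\mathcal L_{\beta_t}(x_t,y_t)^\top u,$$ $$\gamma_t=\min\Big\{\frac{\nabla_y\mathcal L_{\beta_t}(x_t,y_t)^\top(u_t-y_t)}{(L_{yy}+\beta_t)\|u_t-y_t\|^2},1\Big\},\qquad y_{t+1}=y_t+\gamma_t(u_t-y_t)$$ (with $y_{t+1}=y_t$ if $u_t=y_t$). Then the following hold. (i) (C-C) If $\tau_t=\Theta(t^{-2/3})$ and $\beta_t=\Theta(t^{-1/3})$ with $\tau_t,\beta_t>0$ for all $t$, then there is a constant $K$ such that for all $T\ge 0$ $$\frac1{T+1}\sum_{t=0}^T G_{\mathcal X}^{\mathrm{opt}}(x_t)\le K(T+1)^{-1/3},\qquad \frac1{T+1}\sum_{t=0}^T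 G_{\mathcal Y}(x_t,y_t)\le K(T+1)^{-1/3}.$$ (ii) (C-SC) If $\mu>0$, $\tau_t=\Theta(t^{-1/2})$ with $\tau_t>0$, and $\beta_t=0$ for all $t$, then there is a constant $K$ such that for all $T\ge 0$ both averages in (i) are at most $K\,(1+\log(T+1))^{1/2}\,(T+1)^{-1/2}$, that is, $\widetilde O(T^{-1/2})$. (iii) (C-SC with strongly convex $\mathcal Y$) If $\mu>0$, $\tau_t=\Theta(t^{-1/3})$ with $\tau_t>0$, $\beta_t=0$ for all $t$, and $\mathcal Y$ is $\alpha$-strongly convex for some $\alpha>0$, that is, $\xi y+(1-\xi)y'+\xi(1-\xi)\frac{\alpha}{2}\|y-y'\|^2z\in\mathcal Y$ for all $y,y'\in\mathcal Y$, $\xi\in[0,1]$ and $\|z\|=1$, then there is a constant $K$ such that for all $T\ge 0$ both averages in (i) are at most $K\,(1+\log(T+1))^{2/3}\,(T+1)^{-2/3}$, that is, $\widetilde O(T^{-2/3})$. In each part $K$ depends only on the problem ($\mathcal X$, $\mathcal Y$, $\mathcal L$ and its constants, and $\alpha$ in (iii)) and on the sequences $(\tau_t)$, $(\beta_t)$,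 not on $T$, on $(x_0,y_0)$ or on the choices of $u_t$. -/

import Mathlib

open Filter Asymptotics

noncomputable section

namespace Minimax

/-- The Euclidean space `ℝⁿ`. -/
abbrev E (n : ℕ) := EuclideanSpace ℝ (Fin n)

variable {nx ny : ℕ}

/-- The partial gradient `∇ₓ L(x, y)`. -/
def gradX (L : E nx → E ny → ℝ) (x : E nx) (y : E ny) : E nx :=
  gradient (fun x' => L x' y) x

/-- The partial gradient `∇_y L(x, y)`. -/
def gradY (L : E nx → E ny → ℝ) (x : E nx) (y : E ny) : E ny :=
  gradient (fun y' => L x y') y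

/-- Standing assumptions on the problem `min_{x ∈ X} max_{y ∈ Y} L(x, y)`: compact convex feasible
sets, `L(x, ·)` is `μ`-strongly concave on `Y` with `μ ≥ 0` (mere concavity if `μ = 0`),
`L` is continuously differentiable on an open set containing `X × Y`, and the partial gradients
are Lipschitz on `X × Y`. -/
structure Regular (X : Set (E nx)) (Y : Set (E ny)) (L : E nx → E ny → ℝ)
    (μ Lxx Lyx Lyy : ℝ) : Prop where
  isCompact_X : IsCompact X
  convex_X : Convex ℝ X
  isCompact_Y : IsCompact Y
  convex_Y : Convex ℝ Y
  mu_nonneg : 0 ≤ μ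
  strongConcave : ∀ x ∈ X, StrongConcaveOn Y μ (fun y => L x y)
  contDiff : ∃ U : Set (E nx × E ny), IsOpen U ∧ X ×ˢ Y ⊆ U ∧
    ContDiffOn ℝ 1 (fun p : E nx × E ny => L p.1 p.2) U
  Lxx_nonneg : 0 ≤ Lxx
  Lyy_nonneg : 0 ≤ Lyy
  Lyx_pos : 0 < Lyx
  lipschitz_gradX : ∀ x ∈ X, ∀ y ∈ Y, ∀ x' ∈ X, ∀ y' ∈ Y,
    ‖gradX L x y - gradX L x' y'‖ ≤ Lxx * ‖x - x'‖ + Lyx * ‖y - y'‖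
  lipschitz_gradY : ∀ x ∈ X, ∀ y ∈ Y, ∀ x' ∈ X, ∀ y' ∈ Y,
    ‖gradY L x y - gradY L x' y'‖ ≤ Lyx * ‖x - x'‖ + Lyy * ‖y - y'‖

/-- `L` is convex-concave over `X × Y`. -/
def ConvexConcave (X : Set (E nx)) (Y : Set (E ny)) (L : E nx → E ny → ℝ) : Prop :=
  (∀ y ∈ Y, ConvexOn ℝ X (fun x => L x y)) ∧ (∀ x ∈ X, ConcaveOn ℝ Y (fun y => L x y))

/-- `Y` is an `α`-strongly convex set. -/
def StronglyConvexSet (α : ℝ) (Y : Set (E ny)) : Prop :=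
  ∀ y ∈ Y, ∀ y' ∈ Y, ∀ z : E ny, ‖z‖ = 1 → ∀ ξ ∈ Set.Icc (0 : ℝ) 1,
    ξ • y + (1 - ξ) • y' + (ξ * (1 - ξ) * (α / 2) * ‖y - y'‖ ^ 2) • z ∈ Y

/-- The primal function `f(x) = max_{y ∈ Y} L(x, y)`. -/
def primal (Y : Set (E ny)) (L : E nx → E ny → ℝ) (x : E nx) : ℝ :=
  sSup ((fun y => L x y) '' Y)

/-- The primal optimality gap `f(x) - min_{v ∈ X} f(v)`. -/
def gapOpt (X : Set (E nx)) (Y : Set (E ny)) (L : E nx → E ny → ℝ) (x : E nx) : ℝ :=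
  primal Y L x - sInf (primal Y L '' X)

/-- The dual gap `max_{u ∈ Y} L(x, u) - L(x, y)`. -/
def gapY (Y : Set (E ny)) (L : E nx → E ny → ℝ) (x : E nx) (y : E ny) : ℝ :=
  primal Y L x - L x y

/-- `p` is the projection of `w` onto `U`: it minimizes `‖w - v‖²` over `v ∈ U`. -/
def IsPO {n : ℕ} (U : Set (E n)) (w p : E n) : Prop :=
  p ∈ U ∧ IsMinOn (fun v => ‖w - v‖ ^ 2) U p

/-- `p` is an admissible answer of the linear minimization oracle of `U` in direction `d`:
it minimizes `dᵀ v` over `v ∈ U`. -/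
def IsLMO {n : ℕ} (U : Set (E n)) (d p : E n) : Prop :=
  p ∈ U ∧ IsMinOn (fun v => inner ℝ d v) U p

/-- The regularized payoff `L_β(x, y) = L(x, y) - (β / 2) ‖y - y₀‖²`. -/
def regPayoff (L : E nx → E ny → ℝ) (y₀ : E ny) (β : ℝ) (x : E nx) (y : E ny) : ℝ :=
  L x y - β / 2 * ‖y - y₀‖ ^ 2

/-- The dual stepsize `min {∇_y L_β(x, y)ᵀ (u - y) / ((Lyy + β) ‖u - y‖²), 1}`. If `u = y` its
value is immaterial, since it multiplies `u - y` in the update. -/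
def dualStep (L : E nx → E ny → ℝ) (Lyy : ℝ) (y₀ : E ny) (β : ℝ)
    (x : E nx) (y u : E ny) : ℝ :=
  min (inner ℝ (gradY (regPayoff L y₀ β) x y) (u - y) / ((Lyy + β) * ‖u - y‖ ^ 2)) 1

/-- `(x_t, y_t)` with oracle answers `u_t` is a run of the PO-LMO algorithm with primal stepsizes
`τ_t` and smoothing parameters `β_t`; the reference point of the smoothing is `y_0`. -/
structure IsPOLMORun (X : Set (E nx)) (Y : Set (E ny)) (L : E nx → E ny → ℝ) (Lyy : ℝ)
    (τ β : ℕ → ℝ) (x : ℕ → E nx) (y u : ℕ → E ny) : Prop where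
  x_zero : x 0 ∈ X
  y_zero : y 0 ∈ Y
  x_succ : ∀ t, IsPO X (x t - τ t • gradX L (x t) (y t)) (x (t + 1))
  u_mem : ∀ t, IsLMO Y (-gradY (regPayoff L (y 0) (β t)) (x t) (y t)) (u t)
  y_succ : ∀ t, y (t + 1) =
    y t + dualStep L Lyy (y 0) (β t) (x t) (y t) (u t) • (u t - y t)

/-- The average `(1 / (T + 1)) ∑_{t = 0}^{T} g t`. -/
def average (g : ℕ → ℝ) (T : ℕ) : ℝ :=
  (1 / ((T : ℝ) + 1)) * ∑ t ∈ Finset.range (T + 1), g t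

end Minimax

end

/-! ### Sums of powers and the rate for two abstract coupled gap sequences. -/

namespace Minimax

/-! Let `G` be the primal gap at `x_t`, `h` the dual gap at `(x_t, y_t)`, and `d = ‖x_{t+1} - x_t‖`.
The potential is `G + h`.

With `x` fixed, a Frank-Wolfe step lowers `h` by a multiple of `h ^ p`, up to smoothing errors: `p =
2` in general, and `p = 3/2` under strong concavity over a strongly convex `Y`
(`exists_gapY_sq_decrease`, `exists_gapY_rpow_decrease`). If `Lyy = 0`, the payoff is affine in `y`;
smoothing then gives `p = 1`, while strong concavity forces `Y` to be a point.

The projected step gains `d ^ 2 / τ` in the linear part of the primal function and perturbs the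
potential by `O(d ^ 2 + d ‖w - y‖)` terms, where `w` is a maximizer at `x_{t+1}` and `y` is the old
or the new dual iterate (`potential_step`). No smoothness of the primal function is needed.
Boundedness of `Y` alone makes the net error `O(τ)`. If `μ > 0`, then `‖w - y‖ = O(d + √h)`, the
error is `O(τ h + τ ^ q)`, and Young's inequality with `q` conjugate to `p` hides `τ h` in the dual
decrease.

Summing the potential bounds `∑ h ^ p` by the accumulated error `W`, and Hölder bounds `∑ h`. The
three-point inequality bounds the next `G` by `h`, an error and a telescoping term divided by `2 τ`
(`gapOpt_step`), so `∑ G` follows by Abel summation (`exists_rate`). The stepsizes make `W` of order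
`T ^ (1/3)` for smoothing with `p = 2`, `T ^ (2/3)` for smoothing with `p = 1`, and logarithmic in
the strongly concave cases. -/

/-- Induction on `N`: Bernoulli's inequality for the exponent `1 - a` bounds the increment of `N ^
(1 - a)` from below. -/
theorem sum_rpow_neg_le {a : ℝ} (ha : 0 ≤ a) (ha' : a < 1) (N : ℕ) :
    ∑ t ∈ Finset.range N, ((t : ℝ) + 1) ^ (-a) ≤ (N : ℝ) ^ (1 - a) / (1 - a) := by
  have h1 : 0 < 1 - a := by linarith
  induction N with
  | zero => simp [Real.zero_rpow h1.ne']
  | succ N ih =>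
    rw [Finset.sum_range_succ]
    have hN : (0 : ℝ) < (N : ℝ) + 1 := by positivity
    have hinv : (1 : ℝ) / ((N : ℝ) + 1) ≤ 1 := by
      rw [div_le_one hN]; linarith [Nat.cast_nonneg (α := ℝ) N]
    have hb := rpow_one_add_le_one_add_mul_self (s := -(1 / ((N : ℝ) + 1))) (by linarith)
      h1.le (by linarith)
    have hfac : (N : ℝ) ^ (1 - a) =
        ((N : ℝ) + 1) ^ (1 - a) * (1 + -(1 / ((N : ℝ) + 1))) ^ (1 - a) := by
      rw [← Real.mul_rpow hN.le (by linarith)]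
      congr 1
      field_simp
      ring
    have hpow : ((N : ℝ) + 1) ^ (1 - a) = ((N : ℝ) + 1) ^ (-a) * ((N : ℝ) + 1) := by
      rw [sub_eq_neg_add, Real.rpow_add hN, Real.rpow_one]
    have hle : (N : ℝ) ^ (1 - a) ≤ ((N : ℝ) + 1) ^ (1 - a) - (1 - a) * ((N : ℝ) + 1) ^ (-a) := by
      calc (N : ℝ) ^ (1 - a) ≤ ((N : ℝ) + 1) ^ (1 - a) * (1 + (1 - a) * -(1 / ((N : ℝ) + 1))) := by
            rw [hfac]; gcongr
        _ = _ := by rw [hpow]; field_simp; ring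
    have : (N : ℝ) ^ (1 - a) / (1 - a) + ((N : ℝ) + 1) ^ (-a) ≤ ((N : ℝ) + 1) ^ (1 - a) / (1 - a) := by
      rw [div_add' _ _ _ h1.ne', div_le_div_iff_of_pos_right h1]
      linarith
    push_cast
    linarith

theorem sum_inv_le_one_add_log (N : ℕ) :
    ∑ t ∈ Finset.range N, ((t : ℝ) + 1) ^ (-1 : ℝ) ≤ 1 + Real.log N := by
  have h := harmonic_le_one_add_log N
  simp only [harmonic] at h
  push_cast at h
  simpa only [Real.rpow_neg_one] using h

theorem rpow_succ_isTheta (s : ℝ) :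
    (fun t : ℕ => ((t : ℝ) + 1) ^ s) =Θ[atTop] (fun t : ℕ => (t : ℝ) ^ s) := by
  have h : (fun t : ℕ => (t : ℝ) + 1) =Θ[atTop] (fun t : ℕ => (t : ℝ)) := by
    refine ⟨IsBigO.of_bound 2 ?_, IsBigO.of_bound 1 ?_⟩
    · filter_upwards [eventually_ge_atTop 1] with t ht
      have : (1 : ℝ) ≤ t := by exact_mod_cast ht
      rw [Real.norm_of_nonneg (by positivity), Real.norm_of_nonneg (by positivity)]
      linarith
    · filter_upwards with t
      rw [Real.norm_of_nonneg (by positivity), Real.norm_of_nonneg (by positivity)]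
      linarith
  exact h.rpow (Eventually.of_forall fun t => by positivity)
    (Eventually.of_forall fun t => by positivity)

/-- Positivity of every term extends the asymptotic comparison to all indices. The shift to `t + 1`
is essential: at `t = 0` a negative real power takes the default value `0`. -/
theorem exists_bounds_of_isTheta {τ : ℕ → ℝ} {s : ℝ} (hτ : ∀ t, 0 < τ t)
    (h : τ =Θ[atTop] (fun t : ℕ => (t : ℝ) ^ s)) :
    ∃ c C : ℝ, 0 < c ∧ 0 < C ∧
      ∀ t : ℕ, c * ((t : ℝ) + 1) ^ s ≤ τ t ∧ τ t ≤ C * ((t : ℝ) + 1) ^ s := by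
  have h' := h.trans (rpow_succ_isTheta s).symm
  have hpos : ∀ t : ℕ, 0 < ((t : ℝ) + 1) ^ s := fun t => by positivity
  obtain ⟨C, hC⟩ := (isBigO_nat_atTop_iff fun t ht => absurd ht (hpos t).ne').1 h'.1
  obtain ⟨D, hD⟩ := (isBigO_nat_atTop_iff fun t ht => absurd ht (hτ t).ne').1 h'.2
  simp only [Real.norm_of_nonneg (hpos _).le, Real.norm_of_nonneg (hτ _).le] at hC hD
  refine ⟨1 / (|D| + 1), |C| + 1, by positivity, by positivity, fun t => ⟨?_, ?_⟩⟩
  · rw [div_mul_eq_mul_div, one_mul, div_le_iff₀ (by positivity)]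
    nlinarith [hD t, hτ t, le_abs_self D]
  · nlinarith [hC t, hpos t, le_abs_self C]

theorem sum_mul_sub_le {w a : ℕ → ℝ} {A : ℝ} (hw : Monotone w) (hw0 : 0 ≤ w 0)
    (ha : ∀ t, 0 ≤ a t) (haA : ∀ t, a t ≤ A) (N : ℕ) :
    ∑ t ∈ Finset.range (N + 1), w t * (a t - a (t + 1)) ≤ w N * A := by
  -- Keeping the final `-a (N + 1)` is what makes the induction close.
  have key : ∑ t ∈ Finset.range (N + 1), w t * (a t - a (t + 1)) ≤ w N * (A - a (N + 1)) := by
    induction N with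
    | zero => simpa using mul_le_mul_of_nonneg_left (sub_le_sub_right (haA 0) (a 1)) hw0
    | succ N ih =>
      rw [Finset.sum_range_succ]
      have := mul_le_mul_of_nonneg_right (hw (Nat.le_succ N)) (sub_nonneg.2 (haA (N + 1)))
      simp only [Nat.succ_eq_add_one] at this
      linarith
  have := mul_nonneg (hw0.trans (hw (Nat.zero_le N))) (ha (N + 1))
  linarith

/-- Since `τ` need not be monotone, dividing by it would spoil Abel summation. The monotone weight
`(t + 1) ^ s` replaces `1 / τ t`, at the price of the ratio `C / c`. -/
theorem sum_le_of_weighted_telescope {s c C A : ℝ} (hs : 0 ≤ s) (hc : 0 < c)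
    {τ G r a : ℕ → ℝ} (hτ : ∀ t : ℕ, c * ((t : ℝ) + 1) ^ (-s) ≤ τ t)
    (hτ' : ∀ t : ℕ, τ t ≤ C * ((t : ℝ) + 1) ^ (-s)) (hG : ∀ t, 0 ≤ G t) (hr : ∀ t, 0 ≤ r t)
    (ha : ∀ t, 0 ≤ a t) (haA : ∀ t, a t ≤ A)
    (hstep : ∀ t, τ t * G t ≤ τ t * r t + (a t - a (t + 1))) (N : ℕ) :
    ∑ t ∈ Finset.range (N + 1), G t ≤
      C / c * ∑ t ∈ Finset.range (N + 1), r t + A / c * ((N : ℝ) + 1) ^ s := by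
  have hw : Monotone fun t : ℕ => ((t : ℝ) + 1) ^ s := fun i j hij => by
    have : (i : ℝ) ≤ j := by exact_mod_cast hij
    simp only
    gcongr
  have habel := sum_mul_sub_le hw (by positivity) ha haA N
  have hterm : ∀ t : ℕ, c * G t ≤ C * r t + ((t : ℝ) + 1) ^ s * (a t - a (t + 1)) := fun t => by
    have hp : 0 < ((t : ℝ) + 1) ^ s := by positivity
    have hinv : ((t : ℝ) + 1) ^ s * ((t : ℝ) + 1) ^ (-s) = 1 := by
      rw [← Real.rpow_add (by positivity)]; simp
    have h1 : c ≤ ((t : ℝ) + 1) ^ s * τ t := by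
      have := mul_le_mul_of_nonneg_left (hτ t) hp.le
      linear_combination this - c * hinv
    have h2 : ((t : ℝ) + 1) ^ s * τ t ≤ C := by
      have := mul_le_mul_of_nonneg_left (hτ' t) hp.le
      linear_combination this + C * hinv
    have h3 := mul_le_mul_of_nonneg_left (hstep t) hp.le
    have h4 := mul_le_mul_of_nonneg_right h1 (hG t)
    have h5 := mul_le_mul_of_nonneg_right h2 (hr t)
    linarith
  have hsum := Finset.sum_le_sum fun t (_ : t ∈ Finset.range (N + 1)) => hterm t
  rw [← Finset.mul_sum, Finset.sum_add_distrib, ← Finset.mul_sum] at hsum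
  have : c * ∑ t ∈ Finset.range (N + 1), G t ≤
      C * ∑ t ∈ Finset.range (N + 1), r t + ((N : ℝ) + 1) ^ s * A := hsum.trans (by gcongr)
  rw [div_mul_eq_mul_div, div_mul_eq_mul_div, ← add_div, le_div_iff₀ hc]
  linarith

/-- Abstract rate of a pair of gap sequences `G`, `h` whose sum is a potential that decreases by a
multiple of `h ^ p`, up to errors `e` whose partial sums are of order `W`. -/
theorem exists_rate {p s c C cτ Cτ : ℝ} (hp : 1 ≤ p) (hs : 0 ≤ s) (hc : 0 < c) (hC : 0 < C)
    (hcτ : 0 < cτ) (hCτ : 0 < Cτ) {τ e W : ℕ → ℝ}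
    (hτ : ∀ t : ℕ, cτ * ((t : ℝ) + 1) ^ (-s) ≤ τ t ∧ τ t ≤ Cτ * ((t : ℝ) + 1) ^ (-s))
    (he : ∀ t, 0 ≤ e t) (heW : ∀ T, ∑ t ∈ Finset.range (T + 1), e t ≤ C * W T)
    (hW1 : ∀ T, 1 ≤ W T) (hWT : ∀ T : ℕ, W T ≤ (T : ℝ) + 1)
    (hWs : ∀ T : ℕ, ((T : ℝ) + 1) ^ s ≤ ((T : ℝ) + 1) ^ (1 - 1 / p) * W T ^ (1 / p)) :
    ∃ K : ℝ, ∀ G h a : ℕ → ℝ, (∀ t, 0 ≤ G t) → (∀ t, 0 ≤ h t) → (∀ t, 0 ≤ a t) →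
      (∀ t, a t ≤ C) → G 0 ≤ C → h 0 ≤ C →
      (∀ t, G (t + 1) + h (t + 1) ≤ G t + h t - c * h t ^ p + C * e t) →
      (∀ t, G (t + 1) ≤ C * h t + C * e t + (a t - a (t + 1)) / (2 * τ t)) →
      ∀ T : ℕ, average G T ≤ K * W T ^ (1 / p) * ((T : ℝ) + 1) ^ (-(1 / p)) ∧
        average h T ≤ K * W T ^ (1 / p) * ((T : ℝ) + 1) ^ (-(1 / p)) := by
  have hp0 : 0 < p := by linarith
  set H : ℝ := ((2 * C + C * C) / c) ^ (1 / p) with hH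
  have hH0 : 0 ≤ H := by positivity
  set K : ℝ := C + (2 * Cτ / (2 * cτ)) * (C * H + C * C) + C / (2 * cτ) with hK
  have hK0 : 0 ≤ K := by positivity
  refine ⟨K + H, fun G h a hG hh ha haC hG0 hh0 hpot hgap T => ?_⟩
  set B : ℝ := ((T : ℝ) + 1) ^ (1 - 1 / p) * W T ^ (1 / p) with hB
  have hN : (0 : ℝ) < (T : ℝ) + 1 := by positivity
  have hW0 : 0 < W T := by linarith [hW1 T]
  have hB0 : 0 ≤ B := by positivity
  have hWB : W T ≤ B := by
    have h1 : W T = W T ^ (1 - 1 / p) * W T ^ (1 / p) := by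
      rw [← Real.rpow_add hW0]; simp
    rw [hB]
    nth_rewrite 1 [h1]
    have : 0 ≤ 1 - 1 / p := by
      rw [sub_nonneg, div_le_one hp0]; exact hp
    gcongr
    exact hWT T
  have hsump : ∑ t ∈ Finset.range (T + 1), h t ^ p ≤ (2 * C + C * C) / c * W T := by
    have key : ∀ N, c * ∑ t ∈ Finset.range N, h t ^ p + (G N + h N) ≤
        G 0 + h 0 + C * ∑ t ∈ Finset.range N, e t := fun N => by
      induction N with
      | zero => simp
      | succ N ih =>
        rw [Finset.sum_range_succ, Finset.sum_range_succ]
        linarith [hpot N]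
    have h1 := key (T + 1)
    have h2 := mul_le_mul_of_nonneg_left (heW T) hC.le
    have h3 := mul_le_mul_of_nonneg_left (hW1 T) hC.le
    rw [div_mul_eq_mul_div, le_div_iff₀ hc]
    nlinarith [hG (T + 1), hh (T + 1)]
  -- Power-mean (Hölder) inequality; `B` is the common order of all the contributions.
  have hsumh : ∑ t ∈ Finset.range (T + 1), h t ≤ H * B := by
    have h1 := Real.rpow_sum_le_const_mul_sum_rpow (Finset.range (T + 1)) h hp
    simp only [abs_of_nonneg (hh _), Finset.card_range] at h1
    push_cast at h1
    have h2 : (∑ t ∈ Finset.range (T + 1), h t) ^ p ≤ (H * B) ^ p := by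
      refine h1.trans ?_
      rw [Real.mul_rpow hH0 hB0, hB, Real.mul_rpow (by positivity) (by positivity), hH,
        ← Real.rpow_mul (by positivity), ← Real.rpow_mul (by positivity),
        ← Real.rpow_mul (by positivity), sub_mul, one_mul, one_div_mul_cancel hp0.ne',
        Real.rpow_one, Real.rpow_one]
      calc _ ≤ ((T : ℝ) + 1) ^ (p - 1) * ((2 * C + C * C) / c * W T) := by gcongr
        _ = _ := by ring
    exact (Real.rpow_le_rpow_iff (Finset.sum_nonneg fun t _ => hh t) (by positivity) hp0).1 h2
  have hsumG : ∑ t ∈ Finset.range (T + 1), G t ≤ K * B := by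
    have h1 := sum_le_of_weighted_telescope (τ := fun t => 2 * τ t) (G := fun t => G (t + 1))
      (r := fun t => C * h t + C * e t) (a := a) (s := s) (c := 2 * cτ) (C := 2 * Cτ) (A := C)
      hs (by positivity) (fun t => by linarith [(hτ t).1]) (fun t => by linarith [(hτ t).2])
      (fun t => hG _) (fun t => by have := hh t; have := he t; positivity) ha haC (fun t => by
        have hτ0 : 0 < τ t := lt_of_lt_of_le (by positivity) (hτ t).1
        have := mul_le_mul_of_nonneg_left (hgap t) (by positivity : (0 : ℝ) ≤ 2 * τ t)
        rw [mul_add, mul_div_cancel₀ _ (by positivity)] at this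
        exact this) T
    rw [Finset.sum_add_distrib, ← Finset.mul_sum, ← Finset.mul_sum] at h1
    have h2 : ∑ t ∈ Finset.range (T + 1), G t ≤
        ∑ t ∈ Finset.range (T + 1), G (t + 1) + G 0 := by
      rw [← Finset.sum_range_succ']
      exact Finset.sum_le_sum_of_subset_of_nonneg (Finset.range_mono (Nat.le_succ _))
        fun t _ _ => hG t
    have h3 : ∑ t ∈ Finset.range (T + 1), e t ≤ C * B := (heW T).trans (by gcongr)
    have h4 : C ≤ C * B := by nlinarith [hW1 T]
    calc _ ≤ 2 * Cτ / (2 * cτ) * (C * (H * B) + C * (C * B)) + C / (2 * cτ) * B + C * B := by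
            refine h2.trans (add_le_add (h1.trans ?_) (hG0.trans h4))
            gcongr
            exact hWs T
      _ = K * B := by rw [hK]; ring
  have hBN : B / ((T : ℝ) + 1) = W T ^ (1 / p) * ((T : ℝ) + 1) ^ (-(1 / p)) := by
    rw [hB, sub_eq_add_neg, Real.rpow_add hN, Real.rpow_one]
    field_simp
  constructor
  · rw [average, mul_assoc, ← hBN, one_div_mul_eq_div, ← mul_div_assoc]
    gcongr
    nlinarith
  · rw [average, mul_assoc, ← hBN, one_div_mul_eq_div, ← mul_div_assoc]
    gcongr
    nlinarith

end Minimax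

/-! ### First-order inequalities, the primal function and the projected step. -/

namespace Minimax

/-- Restriction to the segment reduces to one variable, so `S` need not be open and `F` need be
differentiable only at `x`. -/
theorem _root_.ConvexOn.add_inner_gradient_le {n : ℕ} {S : Set (E n)} {F : E n → ℝ}
    (hF : ConvexOn ℝ S F) {x z : E n} (hx : x ∈ S) (hz : z ∈ S) (hd : DifferentiableAt ℝ F x) :
    F x + inner ℝ (gradient F x) (z - x) ≤ F z := by
  have hline : HasDerivAt (fun t : ℝ => F (AffineMap.lineMap x z t))
      (inner ℝ (gradient F x) (z - x)) 0 := by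
    rw [inner_gradient_left]
    have h1 : HasDerivAt (fun t : ℝ => AffineMap.lineMap x z t) (z - x) (0 : ℝ) :=
      AffineMap.hasDerivAt_lineMap
    have h2 : HasFDerivAt F (fderiv ℝ F x) (AffineMap.lineMap x z (0 : ℝ)) := by
      simpa using hd.hasFDerivAt
    exact h2.comp_hasDerivAt (0 : ℝ) h1
  have hmem : ∀ t ∈ Set.Icc (0 : ℝ) 1, AffineMap.lineMap x z t ∈ S := fun t ht =>
    hF.1.lineMap_mem hx hz ht
  have hconv : ConvexOn ℝ (Set.Icc (0 : ℝ) 1) (fun t : ℝ => F (AffineMap.lineMap x z t)) :=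
    (hF.comp_affineMap (AffineMap.lineMap x z)).subset hmem (convex_Icc 0 1)
  have h := hconv.le_slope_of_hasDerivAt (x := 0) (y := 1) (by simp) (by simp) one_pos hline
  simp only [slope_def_field, AffineMap.lineMap_apply_zero, AffineMap.lineMap_apply_one, sub_zero,
    div_one] at h
  linarith

variable {nx ny : ℕ} {X : Set (E nx)} {Y : Set (E ny)} {L : E nx → E ny → ℝ}
  {μ Lxx Lyx Lyy : ℝ}

namespace Regular

variable (hreg : Regular X Y L μ Lxx Lyx Lyy) (hcc : ConvexConcave X Y L)
include hreg

theorem differentiableAt {x : E nx} {y : E ny} (hx : x ∈ X) (hy : y ∈ Y) :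
    DifferentiableAt ℝ (fun p : E nx × E ny => L p.1 p.2) (x, y) := by
  obtain ⟨U, hU, hsub, hL⟩ := hreg.contDiff
  exact (hL.differentiableOn one_ne_zero).differentiableAt
    (hU.mem_nhds (hsub (Set.mk_mem_prod hx hy)))

theorem differentiableAt_left {x : E nx} {y : E ny} (hx : x ∈ X) (hy : y ∈ Y) :
    DifferentiableAt ℝ (fun x' => L x' y) x :=
  (hreg.differentiableAt hx hy).comp (f := fun x' : E nx => (x', y)) x (by fun_prop)

theorem differentiableAt_right {x : E nx} {y : E ny} (hx : x ∈ X) (hy : y ∈ Y) :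
    DifferentiableAt ℝ (fun y' => L x y') y :=
  (hreg.differentiableAt hx hy).comp (f := fun y' : E ny => (x, y')) y (by fun_prop)

theorem exists_argmax {x : E nx} (hx : x ∈ X) (hY : Y.Nonempty) :
    ∃ w ∈ Y, primal Y L x = L x w := by
  have hcont : ContinuousOn (fun y => L x y) Y := fun y hy =>
    (hreg.differentiableAt_right hx hy).continuousAt.continuousWithinAt
  obtain ⟨w, hw, h⟩ := hreg.isCompact_Y.exists_sSup_image_eq hY hcont
  exact ⟨w, hw, h⟩

theorem le_primal {x : E nx} {y : E ny} (hx : x ∈ X) (hy : y ∈ Y) : L x y ≤ primal Y L x := by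
  have hcont : ContinuousOn (fun y => L x y) Y := fun y hy =>
    (hreg.differentiableAt_right hx hy).continuousAt.continuousWithinAt
  exact le_csSup (hreg.isCompact_Y.image_of_continuousOn hcont).bddAbove ⟨y, hy, rfl⟩

theorem gapY_nonneg {x : E nx} {y : E ny} (hx : x ∈ X) (hy : y ∈ Y) : 0 ≤ gapY Y L x y :=
  sub_nonneg.2 (hreg.le_primal hx hy)

theorem exists_bound_grad : ∃ M : ℝ, 0 < M ∧
    (∀ x ∈ X, ∀ x' ∈ X, ‖x - x'‖ ≤ M) ∧ (∀ y ∈ Y, ∀ y' ∈ Y, ‖y - y'‖ ≤ M) ∧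
    (∀ x ∈ X, ∀ y ∈ Y, ‖gradX L x y‖ ≤ M) ∧ (∀ x ∈ X, ∀ y ∈ Y, ‖gradY L x y‖ ≤ M) := by
  obtain ⟨DX, hDX⟩ := Metric.isBounded_iff.1 hreg.isCompact_X.isBounded
  obtain ⟨DY, hDY⟩ := Metric.isBounded_iff.1 hreg.isCompact_Y.isBounded
  simp only [dist_eq_norm] at hDX hDY
  rcases X.eq_empty_or_nonempty with rfl | ⟨x₀, hx₀⟩
  · refine ⟨|DY| + 1, by positivity, by simp, fun y hy y' hy' => ?_, by simp, by simp⟩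
    linarith [hDY hy hy', le_abs_self DY]
  rcases Y.eq_empty_or_nonempty with rfl | ⟨y₀, hy₀⟩
  · refine ⟨|DX| + 1, by positivity, fun x hx x' hx' => ?_, by simp, by simp, by simp⟩
    linarith [hDX hx hx', le_abs_self DX]
  have h1 := hreg.Lxx_nonneg
  have h2 := hreg.Lyy_nonneg
  have h3 := hreg.Lyx_pos
  refine ⟨|DX| + |DY| + 1 + (‖gradX L x₀ y₀‖ + ‖gradY L x₀ y₀‖) +
    (Lxx + Lyx) * |DX| + (Lyx + Lyy) * |DY|, by positivity, fun x hx x' hx' => ?_,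
    fun y hy y' hy' => ?_, fun x hx y hy => ?_, fun x hx y hy => ?_⟩
  · have : 0 ≤ |DY| + 1 + (‖gradX L x₀ y₀‖ + ‖gradY L x₀ y₀‖) +
      (Lxx + Lyx) * |DX| + (Lyx + Lyy) * |DY| := by positivity
    linarith [hDX hx hx', le_abs_self DX]
  · have : 0 ≤ |DX| + 1 + (‖gradX L x₀ y₀‖ + ‖gradY L x₀ y₀‖) +
      (Lxx + Lyx) * |DX| + (Lyx + Lyy) * |DY| := by positivity
    linarith [hDY hy hy', le_abs_self DY]
  · have ha := norm_le_norm_add_norm_sub' (gradX L x y) (gradX L x₀ y₀)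
    have hb := hreg.lipschitz_gradX x hx y hy x₀ hx₀ y₀ hy₀
    have hc := mul_le_mul_of_nonneg_left ((hDX hx hx₀).trans (le_abs_self DX)) h1
    have hd := mul_le_mul_of_nonneg_left ((hDY hy hy₀).trans (le_abs_self DY)) h3.le
    have : 0 ≤ |DX| + |DY| + 1 + ‖gradY L x₀ y₀‖ + Lyx * |DX| + Lyy * |DY| := by positivity
    linarith
  · have ha := norm_le_norm_add_norm_sub' (gradY L x y) (gradY L x₀ y₀)
    have hb := hreg.lipschitz_gradY x hx y hy x₀ hx₀ y₀ hy₀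
    have hc := mul_le_mul_of_nonneg_left ((hDX hx hx₀).trans (le_abs_self DX)) h3.le
    have hd := mul_le_mul_of_nonneg_left ((hDY hy hy₀).trans (le_abs_self DY)) h2
    have : 0 ≤ |DX| + |DY| + 1 + ‖gradX L x₀ y₀‖ + Lxx * |DX| + Lyx * |DY| := by positivity
    linarith

include hcc

theorem add_inner_gradX_le {x x' : E nx} {y : E ny} (hx : x ∈ X) (hx' : x' ∈ X) (hy : y ∈ Y) :
    L x y + inner ℝ (gradX L x y) (x' - x) ≤ L x' y :=
  (hcc.1 y hy).add_inner_gradient_le hx hx' (hreg.differentiableAt_left hx hy)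

theorem le_add_inner_gradY {x : E nx} {y y' : E ny} (hx : x ∈ X) (hy : y ∈ Y) (hy' : y' ∈ Y) :
    L x y' ≤ L x y + inner ℝ (gradY L x y) (y' - y) := by
  have h := (hcc.2 x hx).neg.add_inner_gradient_le hy hy' (hreg.differentiableAt_right hx hy).neg
  have hg : gradient (-fun y => L x y) y = -gradY L x y := by
    rw [gradY, gradient, gradient, fderiv_neg, map_neg]
  rw [hg, inner_neg_left] at h
  simp only [Pi.neg_apply] at h
  linarith

/-- One-sided increment of `L(·, w)` between `x` and `x'`, measured with the gradient at
`(x, y)`. -/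
theorem sub_le_inner_gradX_add {x x' : E nx} {y w : E ny} (hx : x ∈ X) (hx' : x' ∈ X)
    (hy : y ∈ Y) (hw : w ∈ Y) :
    L x' w - L x w ≤ inner ℝ (gradX L x y) (x' - x) +
      ‖x' - x‖ * (Lxx * ‖x' - x‖ + Lyx * ‖w - y‖) := by
  have h1 := hreg.add_inner_gradX_le hcc hx' hx hw
  have h2 : inner ℝ (gradX L x' w - gradX L x y) (x' - x) ≤
      (Lxx * ‖x' - x‖ + Lyx * ‖w - y‖) * ‖x' - x‖ :=
    (real_inner_le_norm _ _).trans (by gcongr; exact hreg.lipschitz_gradX x' hx' w hw x hx y hy)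
  rw [inner_sub_left] at h2
  have h3 : inner ℝ (gradX L x' w) (x - x') = -inner ℝ (gradX L x' w) (x' - x) := by
    rw [← inner_neg_right, neg_sub]
  rw [h3] at h1
  linarith

theorem primal_sub_primal_le {x x' : E nx} {y w : E ny} (hx : x ∈ X) (hx' : x' ∈ X)
    (hy : y ∈ Y) (hw : w ∈ Y) (hmax : primal Y L x' = L x' w) :
    primal Y L x' - primal Y L x ≤ inner ℝ (gradX L x y) (x' - x) +
      ‖x' - x‖ * (Lxx * ‖x' - x‖ + Lyx * ‖w - y‖) := by
  have h1 := hreg.sub_le_inner_gradX_add hcc hx hx' hy hw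
  have h2 := hreg.le_primal hx hw
  linarith

/-- The upper bound for the increment of the primal function and the convexity bound for `L(·, y)`
have the same linear term, so it cancels. -/
theorem gapY_sub_gapY_le {x x' : E nx} {y w : E ny} (hx : x ∈ X) (hx' : x' ∈ X)
    (hy : y ∈ Y) (hw : w ∈ Y) (hmax : primal Y L x' = L x' w) :
    gapY Y L x' y - gapY Y L x y ≤ ‖x' - x‖ * (Lxx * ‖x' - x‖ + Lyx * ‖w - y‖) := by
  have h1 := hreg.primal_sub_primal_le hcc hx hx' hy hw hmax
  have h2 := hreg.add_inner_gradX_le hcc hx hx' hy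
  simp only [gapY]
  linarith

/-- A maximizer `w` at `x'` is a competitor at `x`, so the increment is at most that of `L(·, w)`.
-/
theorem exists_primal_lipschitz : ∃ M : ℝ, 0 < M ∧ ∀ x ∈ X, ∀ x' ∈ X, Y.Nonempty →
    primal Y L x' - primal Y L x ≤ M * ‖x' - x‖ := by
  obtain ⟨M, hM, -, -, hgx, -⟩ := hreg.exists_bound_grad
  refine ⟨M, hM, fun x hx x' hx' hY => ?_⟩
  obtain ⟨w, hw, hmax⟩ := hreg.exists_argmax hx' hY
  have h1 := hreg.add_inner_gradX_le hcc hx' hx hw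
  have h2 := hreg.le_primal hx hw
  have h3 : inner ℝ (gradX L x' w) (x' - x) ≤ M * ‖x' - x‖ :=
    (real_inner_le_norm _ _).trans (by gcongr; exact hgx x' hx' w hw)
  have h4 : inner ℝ (gradX L x' w) (x - x') = -inner ℝ (gradX L x' w) (x' - x) := by
    rw [← inner_neg_right, neg_sub]
  linarith

theorem exists_primal_minimizer (hX : X.Nonempty) (hY : Y.Nonempty) :
    ∃ v ∈ X, ∀ x, gapOpt X Y L x = primal Y L x - primal Y L v ∧
      (x ∈ X → 0 ≤ gapOpt X Y L x) := by
  obtain ⟨M, hM, hlip⟩ := hreg.exists_primal_lipschitz hcc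
  have hcont : ContinuousOn (primal Y L) X := by
    refine (LipschitzOnWith.of_dist_le_mul (K := M.toNNReal) fun x hx x' hx' => ?_).continuousOn
    rw [Real.dist_eq, dist_eq_norm, Real.coe_toNNReal M hM.le, abs_le]
    have h1 := hlip x hx x' hx' hY
    have h2 := hlip x' hx' x hx hY
    rw [norm_sub_rev] at h1
    constructor <;> linarith
  obtain ⟨v, hv, h⟩ := hreg.isCompact_X.exists_sInf_image_eq hX hcont
  refine ⟨v, hv, fun x => ⟨by rw [gapOpt, h], fun hx => sub_nonneg.2 ?_⟩⟩
  exact csInf_le (hreg.isCompact_X.image_of_continuousOn hcont).bddBelow ⟨x, hx, rfl⟩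

/-- A single constant fixed by the problem; this keeps the final `K` independent of the run. -/
theorem exists_bound : ∃ D : ℝ, 0 < D ∧
    (∀ x ∈ X, ∀ x' ∈ X, ‖x - x'‖ ≤ D) ∧ (∀ y ∈ Y, ∀ y' ∈ Y, ‖y - y'‖ ≤ D) ∧
    (∀ x ∈ X, ∀ y ∈ Y, ‖gradY L x y‖ ≤ D) ∧
    (∀ x ∈ X, ∀ y ∈ Y, gapOpt X Y L x ≤ D ∧ gapY Y L x y ≤ D) := by
  obtain ⟨M, hM, hX, hY, -, hgy⟩ := hreg.exists_bound_grad
  obtain ⟨M', hM', hlip⟩ := hreg.exists_primal_lipschitz hcc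
  refine ⟨M + M' * M + M * M, by positivity, fun x hx x' hx' => ?_, fun y hy y' hy' => ?_,
    fun x hx y hy => ?_, fun x hx y hy => ⟨?_, ?_⟩⟩
  · nlinarith [hX x hx x' hx']
  · nlinarith [hY y hy y' hy']
  · nlinarith [hgy x hx y hy]
  · obtain ⟨v, hv, h⟩ := hreg.exists_primal_minimizer hcc ⟨x, hx⟩ ⟨y, hy⟩
    rw [(h x).1]
    nlinarith [hlip v hv x hx ⟨y, hy⟩, hX x hx v hv]
  · obtain ⟨w, hw, hmax⟩ := hreg.exists_argmax hx ⟨y, hy⟩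
    have h1 := hreg.le_add_inner_gradY hcc hx hy hw
    have h2 : inner ℝ (gradY L x y) (w - y) ≤ M * M :=
      (real_inner_le_norm _ _).trans
        (mul_le_mul (hgy x hx y hy) (hY w hw y hy) (norm_nonneg _) hM.le)
    rw [gapY, hmax]
    nlinarith

omit hcc in
-- Strong concavity is tested at the midpoint, whence `4 / μ` instead of the sharp `2 / μ`.
theorem sq_norm_sub_le_of_isMax (hμ : 0 < μ) {x : E nx} {y w : E ny} (hx : x ∈ X) (hy : y ∈ Y)
    (hw : w ∈ Y) (hmax : primal Y L x = L x w) :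
    ‖w - y‖ ^ 2 ≤ 4 / μ * (L x w - L x y) := by
  have h := (hreg.strongConcave x hx).2 hw hy (by norm_num : (0 : ℝ) ≤ 1 / 2)
    (by norm_num : (0 : ℝ) ≤ 1 / 2) (by norm_num)
  have h2 := hreg.le_primal hx ((hreg.convex_Y) hw hy (by norm_num : (0 : ℝ) ≤ 1 / 2)
    (by norm_num : (0 : ℝ) ≤ 1 / 2) (by norm_num))
  simp only [smul_eq_mul] at h
  rw [div_mul_eq_mul_div, le_div_iff₀ hμ]
  linarith

omit hcc in
theorem norm_sub_le_of_isMax (hμ : 0 < μ) {x : E nx} {y w : E ny} (hx : x ∈ X) (hy : y ∈ Y)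
    (hw : w ∈ Y) (hmax : primal Y L x = L x w) :
    ‖w - y‖ ≤ √(4 / μ) * √(gapY Y L x y) := by
  rw [← Real.sqrt_mul (by positivity)]
  apply Real.le_sqrt_of_sq_le
  rw [gapY, hmax]
  exact hreg.sq_norm_sub_le_of_isMax hμ hx hy hw hmax

/-- Under strong concavity, maximizers at `x'` are close to any `y` with a small gap at `x`. -/
theorem exists_norm_argmax_sub_le (hμ : 0 < μ) : ∃ C : ℝ, 0 < C ∧
    ∀ x ∈ X, ∀ x' ∈ X, ∀ y ∈ Y, ∀ w ∈ Y, primal Y L x' = L x' w →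
      ‖w - y‖ ≤ C * ‖x' - x‖ + C * √(gapY Y L x y) := by
  have hLxx := hreg.Lxx_nonneg
  have hLyx := hreg.Lyx_pos
  set C₁ : ℝ := 2 * Lyx / μ + √(4 * Lxx / μ) + 1 with hC₁
  refine ⟨C₁ + √(4 / μ), by positivity, fun x hx x' hx' y hy w hw hmax => ?_⟩
  obtain ⟨v, hv, hvmax⟩ := hreg.exists_argmax hx ⟨y, hy⟩
  have hvy := hreg.norm_sub_le_of_isMax hμ hx hy hv hvmax
  have h1 := hreg.sq_norm_sub_le_of_isMax hμ hx' hv hw hmax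
  have h2 := hreg.sq_norm_sub_le_of_isMax hμ hx hw hv hvmax
  have h3 := hreg.sub_le_inner_gradX_add hcc hx hx' hv hw
  have h4 := hreg.add_inner_gradX_le hcc hx hx' hv
  rw [norm_sub_rev v w] at h2
  set d := ‖x' - x‖ with hd
  set Δ := ‖w - v‖ with hΔ
  have hd0 : 0 ≤ d := norm_nonneg _
  have hΔ0 : 0 ≤ Δ := norm_nonneg _
  -- Adding quadratic growth at `x` and at `x'` bounds `Δ ^ 2` by a mixed difference of `L`, in
  -- which the linear terms in `x' - x` cancel.
  have hsq : Δ ^ 2 ≤ (2 * Lyx / μ) * d * Δ + (2 * Lxx / μ) * d ^ 2 := by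
    have : 2 * Δ ^ 2 ≤ 4 / μ * (d * (Lxx * d + Lyx * Δ)) := by
      calc 2 * Δ ^ 2 ≤ 4 / μ * ((L x' w - L x w) - (L x' v - L x v)) := by linarith
        _ ≤ _ := by gcongr; linarith
    calc Δ ^ 2 ≤ 4 / μ * (d * (Lxx * d + Lyx * Δ)) / 2 := by linarith
      _ = _ := by ring
  -- The root in `C₁` carries twice the coefficient of `d ^ 2` in `hsq`. If `Δ` exceeded `C₁ * d`,
  -- that term would therefore vanish, leaving `Δ ≤ (2 * Lyx / μ) * d`.
  have hwv : Δ ≤ C₁ * d := by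
    by_contra! hlt
    have ha : √(4 * Lxx / μ) ^ 2 = 2 * (2 * Lxx / μ) := by
      rw [Real.sq_sqrt (by positivity)]; ring
    have hs : 0 ≤ √(4 * Lxx / μ) := Real.sqrt_nonneg _
    have hb : 0 ≤ 2 * Lyx / μ := by positivity
    have hΔpos : 0 < Δ := lt_of_le_of_lt (by positivity) hlt
    have e1 : (2 * Lyx / μ) * d * Δ + (√(4 * Lxx / μ) * d) * Δ ≤ Δ * Δ := by
      rw [hC₁] at hlt
      nlinarith
    have e2 : (√(4 * Lxx / μ) * d) * (√(4 * Lxx / μ) * d) ≤ (√(4 * Lxx / μ) * d) * Δ := by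
      gcongr
      rw [hC₁] at hlt
      nlinarith [mul_nonneg hb hd0]
    have e3 : 2 * (2 * Lxx / μ) * d ^ 2 ≤ (2 * Lxx / μ) * d ^ 2 := by
      rw [← ha]; nlinarith
    have e4 : (2 * Lxx / μ) * d ^ 2 = 0 := by
      have : 0 ≤ (2 * Lxx / μ) * d ^ 2 := by positivity
      linarith
    have e5 : Δ ≤ (2 * Lyx / μ) * d := by
      refine le_of_mul_le_mul_right ?_ hΔpos
      nlinarith
    rw [hC₁] at hlt
    nlinarith [mul_nonneg hs hd0]
  have htri : ‖w - y‖ ≤ Δ + ‖v - y‖ := norm_sub_le_norm_sub_add_norm_sub w v y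
  have : 0 ≤ √(4 / μ) * d := by positivity
  have : 0 ≤ C₁ * √(gapY Y L x y) := by positivity
  nlinarith

end Regular

theorem IsPO.inner_nonneg {n : ℕ} {U : Set (E n)} (hU : Convex ℝ U) {w p v : E n}
    (h : IsPO U w p) (hv : v ∈ U) : 0 ≤ inner ℝ (w - p) (p - v) := by
  have hne : Nonempty U := ⟨⟨p, h.1⟩⟩
  have hinf : ‖w - p‖ = ⨅ q : U, ‖w - q‖ := by
    refine le_antisymm (le_ciInf fun q => ?_) (ciInf_le ⟨0, ?_⟩ (⟨p, h.1⟩ : U))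
    · exact (sq_le_sq₀ (norm_nonneg _) (norm_nonneg _)).1 (h.2 q.2)
    · rintro _ ⟨q, rfl⟩
      exact norm_nonneg _
  have := (norm_eq_iInf_iff_real_inner_le_zero hU h.1).1 hinf v hv
  rw [← neg_sub v p, inner_neg_right]
  linarith

/-- Three-point inequality of a projected gradient step. -/
theorem IsPO.inner_le {n : ℕ} {U : Set (E n)} (hU : Convex ℝ U) {x g p v : E n} {τ : ℝ}
    (hτ : 0 < τ) (h : IsPO U (x - τ • g) p) (hv : v ∈ U) :
    inner ℝ g (p - v) ≤ (‖x - v‖ ^ 2 - ‖p - v‖ ^ 2) / (2 * τ) - ‖p - x‖ ^ 2 / (2 * τ) := by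
  have h1 := h.inner_nonneg hU hv
  have h2 : x - τ • g - p = (x - v) - (p - v) - τ • g := by abel
  rw [h2, inner_sub_left, inner_sub_left, real_inner_smul_left, real_inner_self_eq_norm_sq] at h1
  have h3 : ‖p - x‖ ^ 2 = ‖x - v‖ ^ 2 - 2 * inner ℝ (x - v) (p - v) + ‖p - v‖ ^ 2 := by
    rw [← norm_sub_sq_real, sub_sub_sub_cancel_right, norm_sub_rev]
  rw [← sub_div, le_div_iff₀ (by positivity)]
  linarith

namespace Regular

variable (hreg : Regular X Y L μ Lxx Lyx Lyy) (hcc : ConvexConcave X Y L)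
include hreg hcc

/-- Testing the projection against `x` itself makes the linear term at most `-‖x' - x‖ ^ 2 / τ`. The
primal function is perturbed through `y` and the dual gap through `y'`, hence both distances. -/
theorem potential_step {x x' : E nx} {y y' w : E ny} {τ : ℝ} (hτ : 0 < τ) (hx : x ∈ X)
    (hy : y ∈ Y) (hy' : y' ∈ Y) (hw : w ∈ Y) (hmax : primal Y L x' = L x' w)
    (hx' : IsPO X (x - τ • gradX L x y) x') :
    gapOpt X Y L x' + gapY Y L x' y' ≤ gapOpt X Y L x + gapY Y L x y' - ‖x' - x‖ ^ 2 / τ +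
      (2 * Lxx * ‖x' - x‖ ^ 2 + Lyx * ‖x' - x‖ * (‖w - y‖ + ‖w - y'‖)) := by
  have h1 := hreg.primal_sub_primal_le hcc hx hx'.1 hy hw hmax
  have h2 := hreg.gapY_sub_gapY_le hcc hx hx'.1 hy' hw hmax
  have h3 := hx'.inner_le hreg.convex_X hτ hx
  simp only [sub_self, norm_zero] at h3
  have h4 : (0 ^ 2 - ‖x' - x‖ ^ 2) / (2 * τ) - ‖x' - x‖ ^ 2 / (2 * τ) = -(‖x' - x‖ ^ 2 / τ) := by
    field_simp
    ring
  simp only [gapOpt]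
  linarith

/-- Split the primal value at `x'` into `L x' y` and the dual gap there. The projected-gradient
inequality against `v` handles the first and `gapY_sub_gapY_le` the second, while `L v y`
underestimates the primal value at `v`. -/
theorem gapOpt_step {x x' v : E nx} {y w : E ny} {τ : ℝ} (hτ : 0 < τ) (hx : x ∈ X)
    (hy : y ∈ Y) (hw : w ∈ Y) (hmax : primal Y L x' = L x' w) (hv : v ∈ X)
    (hx' : IsPO X (x - τ • gradX L x y) x') :
    primal Y L x' - primal Y L v ≤ gapY Y L x y +
      (‖x - v‖ ^ 2 - ‖x' - v‖ ^ 2) / (2 * τ) - ‖x' - x‖ ^ 2 / (2 * τ) +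
      (2 * Lxx * ‖x' - x‖ ^ 2 + Lyx * ‖x' - x‖ * ‖w - y‖) := by
  have h1 := hreg.gapY_sub_gapY_le hcc hx hx'.1 hy hw hmax
  have h2 := hreg.sub_le_inner_gradX_add hcc hx hx'.1 hy hy
  have h3 := hreg.add_inner_gradX_le hcc hx hv hy
  have h4 := hx'.inner_le hreg.convex_X hτ hv
  have h5 := hreg.le_primal hv hy
  have h6 : inner ℝ (gradX L x y) (x' - v) =
      inner ℝ (gradX L x y) (x' - x) - inner ℝ (gradX L x y) (v - x) := by
    rw [← inner_sub_right, sub_sub_sub_cancel_right]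
  simp only [sub_self, norm_zero, mul_zero, add_zero] at h2
  have h7 : gapY Y L x' y = primal Y L x' - L x' y := rfl
  linarith

end Regular

end Minimax

/-! ### Decrease of the dual gap in a Frank-Wolfe step. -/

namespace Minimax

variable {nx ny : ℕ} {X : Set (E nx)} {Y : Set (E ny)} {L : E nx → E ny → ℝ}
  {μ Lxx Lyx Lyy : ℝ}

namespace Regular

variable (hreg : Regular X Y L μ Lxx Lyx Lyy) (hcc : ConvexConcave X Y L)
include hreg

theorem gradY_regPayoff {x : E nx} {y : E ny} (hx : x ∈ X) (hy : y ∈ Y) (y₀ : E ny) (β : ℝ) :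
    gradY (regPayoff L y₀ β) x y = gradY L x y - β • (y - y₀) := by
  refine HasGradientAt.gradient ?_
  rw [hasGradientAt_iff_hasFDerivAt, map_sub, map_smul]
  have h1 := hasGradientAt_iff_hasFDerivAt.1 (hreg.differentiableAt_right hx hy).hasGradientAt
  have h2 := (((hasFDerivAt_id y).sub_const y₀).norm_sq).const_mul (β / 2)
  refine (h1.sub h2).congr_fderiv ?_
  ext v
  simp [gradY, InnerProductSpace.toDual_apply_apply]
  ring

include hcc

/-- Quadratic lower bound along `Y`; the constant `3 / 4` comes from two half steps. -/
theorem add_inner_gradY_sub_le {x : E nx} {y z : E ny} (hx : x ∈ X) (hy : y ∈ Y) (hz : z ∈ Y) :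
    L x y + inner ℝ (gradY L x y) (z - y) - 3 / 4 * Lyy * ‖z - y‖ ^ 2 ≤ L x z := by
  set m : E ny := (1 / 2 : ℝ) • y + (1 / 2 : ℝ) • z with hmdef
  have hm : m ∈ Y := hreg.convex_Y hy hz (by norm_num) (by norm_num) (by norm_num)
  have e1 : m - z = -((1 / 2 : ℝ) • (z - y)) := by rw [hmdef]; module
  have e2 : y - m = -((1 / 2 : ℝ) • (z - y)) := by rw [hmdef]; module
  have h1 := hreg.le_add_inner_gradY hcc hx hz hm
  have h2 := hreg.le_add_inner_gradY hcc hx hm hy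
  have hl1 := hreg.lipschitz_gradY x hx z hz x hx y hy
  have hl2 := hreg.lipschitz_gradY x hx m hm x hx y hy
  have e3 : m - y = (1 / 2 : ℝ) • (z - y) := by rw [hmdef]; module
  rw [sub_self, norm_zero, mul_zero, zero_add] at hl1 hl2
  rw [e3, norm_smul, Real.norm_of_nonneg (by norm_num : (0 : ℝ) ≤ 1 / 2)] at hl2
  rw [e1, inner_neg_right, real_inner_smul_right] at h1
  rw [e2, inner_neg_right, real_inner_smul_right] at h2
  have k1 := neg_le_of_abs_le ((abs_real_inner_le_norm (gradY L x z - gradY L x y) (z - y)).trans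
    (mul_le_mul_of_nonneg_right hl1 (norm_nonneg _)))
  have k2 := neg_le_of_abs_le ((abs_real_inner_le_norm (gradY L x m - gradY L x y) (z - y)).trans
    (mul_le_mul_of_nonneg_right hl2 (norm_nonneg _)))
  rw [inner_sub_left] at k1 k2
  linarith

/-- With `Lyy = 0` the payoff is affine along segments of `Y`, contradicting strong concavity on a
nontrivial one. -/
theorem subsingleton_of_Lyy_eq_zero (hμ : 0 < μ) (hX : X.Nonempty) (hL : Lyy = 0) :
    Y.Subsingleton := by
  intro y hy z hz
  obtain ⟨x, hx⟩ := hX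
  set m : E ny := (1 / 2 : ℝ) • y + (1 / 2 : ℝ) • z with hmdef
  have hm : m ∈ Y := hreg.convex_Y hy hz (by norm_num) (by norm_num) (by norm_num)
  have h1 := hreg.add_inner_gradY_sub_le hcc hx hm hy
  have h2 := hreg.add_inner_gradY_sub_le hcc hx hm hz
  have e1 : y - m = -(z - m) := by rw [hmdef]; module
  rw [e1, inner_neg_right, hL] at h1
  rw [hL] at h2
  have h3 := (hreg.strongConcave x hx).2 hy hz (by norm_num : (0 : ℝ) ≤ 1 / 2)
    (by norm_num : (0 : ℝ) ≤ 1 / 2) (by norm_num)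
  simp only [smul_eq_mul] at h3
  have h4 : μ * ‖y - z‖ ^ 2 ≤ 0 := by linarith
  have h5 : ‖y - z‖ ^ 2 ≤ 0 := by
    by_contra! hlt
    exact absurd h4 (not_le.2 (mul_pos hμ hlt))
  exact sub_eq_zero.1 (norm_eq_zero.1 (pow_eq_zero_iff two_ne_zero |>.1
    (le_antisymm h5 (by positivity))))

omit hcc in
theorem dualStep_mem_Icc {x : E nx} {y u y₀ : E ny} {β : ℝ} (hβ : 0 ≤ β) (hy : y ∈ Y)
    (hu : IsLMO Y (-gradY (regPayoff L y₀ β) x y) u) :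
    0 ≤ inner ℝ (gradY (regPayoff L y₀ β) x y) (u - y) ∧
      0 ≤ dualStep L Lyy y₀ β x y u ∧ dualStep L Lyy y₀ β x y u ≤ 1 := by
  have h := hu.2 hy
  simp only [inner_neg_left, Set.mem_ofPred_eq] at h
  have hg : 0 ≤ inner ℝ (gradY (regPayoff L y₀ β) x y) (u - y) := by
    rw [inner_sub_right]; linarith
  have := hreg.Lyy_nonneg
  exact ⟨hg, le_min (div_nonneg hg (by positivity)) zero_le_one, min_le_right _ _⟩

omit hcc in
theorem add_dualStep_smul_mem {x : E nx} {y u y₀ : E ny} {β : ℝ} (hβ : 0 ≤ β) (hy : y ∈ Y)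
    (hu : IsLMO Y (-gradY (regPayoff L y₀ β) x y) u) :
    y + dualStep L Lyy y₀ β x y u • (u - y) ∈ Y := by
  obtain ⟨-, h0, h1⟩ := hreg.dualStep_mem_Icc hβ hy hu
  exact hreg.convex_Y.add_smul_sub_mem hy hu.1 ⟨h0, h1⟩

/-- Increase of the payoff along a Frank-Wolfe step for the regularized payoff. -/
theorem frankWolfe_gain {x : E nx} {y u y₀ : E ny} {β : ℝ} (hβ : 0 ≤ β) (hx : x ∈ X) (hy : y ∈ Y)
    (hu : IsLMO Y (-gradY (regPayoff L y₀ β) x y) u) :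
    dualStep L Lyy y₀ β x y u * (Lyy + β) * ‖u - y‖ ^ 2 ≤
        inner ℝ (gradY (regPayoff L y₀ β) x y) (u - y) ∧
      L x y + dualStep L Lyy y₀ β x y u *
          inner ℝ (gradY (regPayoff L y₀ β) x y) (u - y) / 4 -
          β * (dualStep L Lyy y₀ β x y u * ‖u - y‖) * ‖y - y₀‖ ≤
        L x (y + dualStep L Lyy y₀ β x y u • (u - y)) := by
  obtain ⟨hg, h0, h1⟩ := hreg.dualStep_mem_Icc hβ hy hu
  have hmem := hreg.add_dualStep_smul_mem hβ hy hu
  have hstep : dualStep L Lyy y₀ β x y u * (Lyy + β) * ‖u - y‖ ^ 2 ≤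
      inner ℝ (gradY (regPayoff L y₀ β) x y) (u - y) := by
    have hL := hreg.Lyy_nonneg
    rcases (show 0 ≤ (Lyy + β) * ‖u - y‖ ^ 2 by positivity).eq_or_lt with h | h
    · rw [mul_assoc, ← h, mul_zero]; exact hg
    · rw [mul_assoc, ← le_div_iff₀ h]
      exact min_le_left _ _
  refine ⟨hstep, ?_⟩
  set γ := dualStep L Lyy y₀ β x y u with hγ
  have hdesc := hreg.add_inner_gradY_sub_le hcc hx hy hmem
  rw [add_sub_cancel_left, real_inner_smul_right, norm_smul, Real.norm_of_nonneg h0] at hdesc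
  have hG : inner ℝ (gradY (regPayoff L y₀ β) x y) (u - y) =
      inner ℝ (gradY L x y) (u - y) - β * inner ℝ (y - y₀) (u - y) := by
    rw [hreg.gradY_regPayoff hx hy, inner_sub_left, real_inner_smul_left]
  have hin : -(‖y - y₀‖ * ‖u - y‖) ≤ inner ℝ (y - y₀) (u - y) :=
    neg_le_of_abs_le (abs_real_inner_le_norm _ _)
  set g := inner ℝ (gradY (regPayoff L y₀ β) x y) (u - y) with hgdef
  -- By the step rule the curvature term costs at most `3 / 4` of `γ * g`; the remaining quarter is
  -- the gain.
  have k1 := mul_le_mul_of_nonneg_left hstep h0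
  have k2 := mul_le_mul_of_nonneg_left hin (mul_nonneg h0 hβ)
  have k3 : 0 ≤ β * (γ * ‖u - y‖) ^ 2 := by positivity
  have k4 : inner ℝ (gradY L x y) (u - y) = g + β * inner ℝ (y - y₀) (u - y) := by linarith
  rw [k4] at hdesc
  nlinarith

/-- Concavity bounds the gap by the linearization at a maximizer, which the oracle answer dominates;
removing the smoothing costs `β * D ^ 2`. -/
theorem gapY_le_linearized_gap {x : E nx} {y u y₀ : E ny} {β : ℝ} (hx : x ∈ X) (hy : y ∈ Y)
    (hu : IsLMO Y (-gradY (regPayoff L y₀ β) x y) u) {D : ℝ} (hβ : 0 ≤ β)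
    (hD : ∀ y ∈ Y, ∀ y' ∈ Y, ‖y - y'‖ ≤ D) (hy₀ : y₀ ∈ Y) :
    gapY Y L x y ≤ inner ℝ (gradY (regPayoff L y₀ β) x y) (u - y) + β * D ^ 2 := by
  obtain ⟨v, hv, hmax⟩ := hreg.exists_argmax hx ⟨y, hy⟩
  have h1 := hreg.le_add_inner_gradY hcc hx hy hv
  have h2 := hu.2 hv
  simp only [inner_neg_left, Set.mem_ofPred_eq] at h2
  have h3 : inner ℝ (gradY (regPayoff L y₀ β) x y) (v - y) =
      inner ℝ (gradY L x y) (v - y) - β * inner ℝ (y - y₀) (v - y) := by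
    rw [hreg.gradY_regPayoff hx hy, inner_sub_left, real_inner_smul_left]
  have h4 : inner ℝ (y - y₀) (v - y) ≤ D ^ 2 := by
    refine (real_inner_le_norm _ _).trans ?_
    rw [sq]
    exact mul_le_mul (hD y hy y₀ hy₀) (hD v hv y hy) (norm_nonneg _)
      ((norm_nonneg _).trans (hD y hy y₀ hy₀))
  have h5 := mul_le_mul_of_nonneg_left h4 hβ
  rw [inner_sub_right] at h3 ⊢
  rw [gapY, hmax]
  linarith

theorem exists_gapY_sq_decrease (hL : 0 < Lyy) {B : ℝ} (hB : 0 ≤ B) : ∃ c C : ℝ, 0 < c ∧ 0 < C ∧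
    ∀ x ∈ X, ∀ y ∈ Y, ∀ y₀ ∈ Y, ∀ β u, 0 ≤ β → β ≤ B →
      IsLMO Y (-gradY (regPayoff L y₀ β) x y) u →
      gapY Y L x (y + dualStep L Lyy y₀ β x y u • (u - y)) ≤
        gapY Y L x y - c * gapY Y L x y ^ 2 + C * β ^ 2 := by
  obtain ⟨D, hD, -, hY, hgrad, -⟩ := hreg.exists_bound hcc
  -- The two summands of the denominator serve the two arms of the minimum in `dualStep`, so that
  -- `dualStep` is at least `c₁` times the linearized gap unless `u = y`.
  set c₁ : ℝ := 1 / ((Lyy + B) * D ^ 2 + (D + B * D) * D) with hc₁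
  have hc₁0 : 0 < c₁ := by positivity
  refine ⟨c₁ / 16, c₁ / 8 * D ^ 4 + 2 * D ^ 2 / Lyy, by positivity, by positivity,
    fun x hx y hy y₀ hy₀ β u hβ hβB hu => ?_⟩
  obtain ⟨hg, h0, h1⟩ := hreg.dualStep_mem_Icc hβ hy hu
  obtain ⟨hstep, hgain⟩ := hreg.frankWolfe_gain hcc hβ hx hy hu
  have hgap := hreg.gapY_le_linearized_gap hcc hx hy hu hβ hY hy₀
  have hgap0 := hreg.gapY_nonneg hx hy
  have hgD : inner ℝ (gradY (regPayoff L y₀ β) x y) (u - y) ≤ (D + B * D) * D := by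
    refine (real_inner_le_norm _ _).trans (mul_le_mul ?_ (hY u hu.1 y hy) (norm_nonneg _)
      (by positivity))
    rw [hreg.gradY_regPayoff hx hy]
    refine (norm_sub_le _ _).trans (add_le_add (hgrad x hx y hy) ?_)
    rw [norm_smul, Real.norm_of_nonneg hβ]
    exact mul_le_mul hβB (hY y hy y₀ hy₀) (norm_nonneg _) hB
  have hs := hY u hu.1 y hy
  have hy₀D := hY y hy y₀ hy₀
  have hγg : c₁ * inner ℝ (gradY (regPayoff L y₀ β) x y) (u - y) ^ 2 ≤
      dualStep L Lyy y₀ β x y u * inner ℝ (gradY (regPayoff L y₀ β) x y) (u - y) := by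
    rcases eq_or_ne u y with rfl | hne
    · simp
    rw [sq, ← mul_assoc]
    refine mul_le_mul_of_nonneg_right (le_min ?_ ?_) hg
    · have hpos : 0 < ‖u - y‖ := norm_pos_iff.2 (sub_ne_zero.2 hne)
      rw [hc₁, one_div_mul_eq_div]
      gcongr
      calc (Lyy + β) * ‖u - y‖ ^ 2 ≤ (Lyy + B) * D ^ 2 := by gcongr
        _ ≤ _ := le_add_of_nonneg_right (by positivity)
    · rw [hc₁, one_div_mul_eq_div, div_le_one (by positivity)]
      exact hgD.trans (le_add_of_nonneg_left (by positivity))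
  set γ := dualStep L Lyy y₀ β x y u
  set g := inner ℝ (gradY (regPayoff L y₀ β) x y) (u - y)
  set δ := γ * ‖u - y‖ with hδ
  have hδ0 : 0 ≤ δ := by positivity
  have k1 : Lyy * δ ^ 2 ≤ γ * g := by
    have := mul_le_mul_of_nonneg_left hstep h0
    have h2 : 0 ≤ β * δ ^ 2 := by positivity
    rw [hδ] at h2 ⊢
    nlinarith
  -- Half of the gain absorbs the cross term, so smoothing costs `β ^ 2` rather than `β`. This needs
  -- `Lyy > 0`.
  have k2 : β * δ * ‖y - y₀‖ ≤ Lyy * δ ^ 2 / 8 + 2 * D ^ 2 / Lyy * β ^ 2 := by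
    have e1 : β * δ * ‖y - y₀‖ ≤ β * δ * D := by gcongr
    have e2 : Lyy * δ ^ 2 / 8 + 2 * D ^ 2 / Lyy * β ^ 2 - β * δ * D =
        (Lyy * δ - 4 * (D * β)) ^ 2 / (8 * Lyy) := by
      field_simp
      ring
    have : 0 ≤ (Lyy * δ - 4 * (D * β)) ^ 2 / (8 * Lyy) := by positivity
    linarith
  have k3 : gapY Y L x y ^ 2 ≤ 2 * g ^ 2 + 2 * (β * D ^ 2) ^ 2 := by
    have := pow_le_pow_left₀ hgap0 hgap 2
    nlinarith [sq_nonneg (g - β * D ^ 2)]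
  have k4 := mul_le_mul_of_nonneg_left k3 hc₁0.le
  simp only [gapY] at k4 ⊢
  linarith

/-- Without curvature the step is a full one as soon as the linearized gap reaches `β * D ^ 2`.
Below that threshold the dual gap is already `O(β)`. -/
theorem exists_gapY_linear_decrease (hL : Lyy = 0) : ∃ C : ℝ, 0 < C ∧
    ∀ x ∈ X, ∀ y ∈ Y, ∀ y₀ ∈ Y, ∀ β u, 0 < β →
      IsLMO Y (-gradY (regPayoff L y₀ β) x y) u →
      gapY Y L x (y + dualStep L Lyy y₀ β x y u • (u - y)) ≤
        gapY Y L x y - 1 / 4 * gapY Y L x y + C * β := by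
  obtain ⟨D, hD, -, hY, -, -⟩ := hreg.exists_bound hcc
  refine ⟨2 * D ^ 2, by positivity, fun x hx y hy y₀ hy₀ β u hβ hu => ?_⟩
  obtain ⟨hg, h0, h1⟩ := hreg.dualStep_mem_Icc hβ.le hy hu
  obtain ⟨-, hgain⟩ := hreg.frankWolfe_gain hcc hβ.le hx hy hu
  have hgap := hreg.gapY_le_linearized_gap hcc hx hy hu hβ.le hY hy₀
  have hs := hY u hu.1 y hy
  have hγ1 : β * D ^ 2 ≤ inner ℝ (gradY (regPayoff L y₀ β) x y) (u - y) →
      dualStep L Lyy y₀ β x y u = 1 := fun hle => by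
    rcases eq_or_ne u y with rfl | hne
    · rw [sub_self, inner_zero_right] at hle
      exact absurd hle (not_le.2 (by positivity))
    have hpos : 0 < ‖u - y‖ := norm_pos_iff.2 (sub_ne_zero.2 hne)
    rw [dualStep, min_eq_right_iff, hL, zero_add, le_div_iff₀ (by positivity), one_mul]
    exact le_trans (by gcongr) hle
  have k1 : β * (dualStep L Lyy y₀ β x y u * ‖u - y‖) * ‖y - y₀‖ ≤ β * D ^ 2 := by
    calc _ ≤ β * (1 * D) * D := by gcongr; exact hY y hy y₀ hy₀
      _ = _ := by ring
  simp only [gapY] at hgap ⊢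
  rcases le_total (β * D ^ 2) (inner ℝ (gradY (regPayoff L y₀ β) x y) (u - y)) with hle | hle
  · rw [hγ1 hle] at hgain k1 ⊢
    have : 0 ≤ β * D ^ 2 := by positivity
    linarith
  · have := mul_nonneg h0 hg
    linarith

omit hreg hcc in
-- The midpoint of `u` and `y`, pushed by `α / 8 * ‖u - y‖ ^ 2` along `G / ‖G‖`, stays in `Y`;
-- compare it with the optimal `u`.
theorem _root_.Minimax.StronglyConvexSet.sq_norm_mul_norm_le {α : ℝ}
    (hY : StronglyConvexSet α Y) {y u G : E ny} (hy : y ∈ Y) (hu : IsLMO Y (-G) u) :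
    α / 4 * ‖u - y‖ ^ 2 * ‖G‖ ≤ inner ℝ G (u - y) := by
  rcases eq_or_ne G 0 with rfl | hG
  · simp
  have hG' : 0 < ‖G‖ := norm_pos_iff.2 hG
  have hz : ‖(‖G‖⁻¹ • G)‖ = 1 := by
    rw [norm_smul, norm_inv, norm_norm, inv_mul_cancel₀ hG'.ne']
  have hmem := hY u hu.1 y hy _ hz (1 / 2) (by norm_num)
  have h := hu.2 hmem
  simp only [inner_neg_left, Set.mem_ofPred_eq, inner_add_right, real_inner_smul_right,
    real_inner_self_eq_norm_sq] at h
  have e : ‖G‖⁻¹ * ‖G‖ ^ 2 = ‖G‖ := by field_simp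
  rw [e] at h
  rw [inner_sub_right]
  linarith

theorem exists_gapY_rpow_decrease (hμ : 0 < μ) (hL : 0 < Lyy) {α : ℝ} (hα : 0 < α)
    (hS : StronglyConvexSet α Y) : ∃ c : ℝ, 0 < c ∧
    ∀ x ∈ X, ∀ y ∈ Y, ∀ y₀ ∈ Y, ∀ u, IsLMO Y (-gradY (regPayoff L y₀ 0) x y) u →
      gapY Y L x (y + dualStep L Lyy y₀ 0 x y u • (u - y)) ≤
        gapY Y L x y - c * (gapY Y L x y * √(gapY Y L x y)) := by
  obtain ⟨D, hD, -, hY, -, hgapD⟩ := hreg.exists_bound hcc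
  set κ : ℝ := √(4 / μ) with hκ
  have hκ0 : 0 < κ := by positivity
  set c₁ : ℝ := α / (4 * Lyy * κ) with hc₁
  set c₂ : ℝ := 1 / √D with hc₂
  have hc₁0 : 0 < c₁ := by positivity
  have hc₂0 : 0 < c₂ := by positivity
  refine ⟨min c₁ c₂ / 4, by positivity, fun x hx y hy y₀ hy₀ u hu => ?_⟩
  obtain ⟨hg, h0, h1⟩ := hreg.dualStep_mem_Icc le_rfl hy hu
  obtain ⟨-, hgain⟩ := hreg.frankWolfe_gain hcc le_rfl hx hy hu
  have hgap := hreg.gapY_le_linearized_gap hcc hx hy hu le_rfl hY hy₀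
  have hgap0 := hreg.gapY_nonneg hx hy
  have hsc := hS.sq_norm_mul_norm_le hy hu
  set r := √(gapY Y L x y) with hr
  have hr0 : 0 ≤ r := Real.sqrt_nonneg _
  have hrsq : r * r = gapY Y L x y := Real.mul_self_sqrt hgap0
  -- Error bound: the gap is at most the gradient norm times the distance to a maximizer, and that
  -- distance is at most `κ * r`.
  have hrG : r ≤ κ * ‖gradY (regPayoff L y₀ 0) x y‖ := by
    obtain ⟨v, hv, hmax⟩ := hreg.exists_argmax hx ⟨y, hy⟩
    have h2 := hreg.le_add_inner_gradY hcc hx hy hv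
    have h3 := hreg.norm_sub_le_of_isMax hμ hx hy hv hmax
    rw [hreg.gradY_regPayoff hx hy, zero_smul, sub_zero]
    have h4 : r * r ≤ κ * ‖gradY L x y‖ * r := by
      rw [hrsq, gapY, hmax]
      calc L x v - L x y ≤ inner ℝ (gradY L x y) (v - y) := by linarith
        _ ≤ ‖gradY L x y‖ * ‖v - y‖ := real_inner_le_norm _ _
        _ ≤ ‖gradY L x y‖ * (κ * r) := by gcongr
        _ = _ := by ring
    rcases hr0.eq_or_lt with h | h
    · rw [← h]; positivity
    · exact le_of_mul_le_mul_right h4 h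
  have hrD : c₂ * r ≤ 1 := by
    rw [hc₂, one_div_mul_eq_div, div_le_one (by positivity)]
    exact Real.sqrt_le_sqrt (hgapD x hx y hy).2
  rw [zero_mul, add_zero] at hgap
  rw [zero_mul, zero_mul, sub_zero] at hgain
  have key : min c₁ c₂ * (gapY Y L x y * r) ≤
      dualStep L Lyy y₀ 0 x y u * inner ℝ (gradY (regPayoff L y₀ 0) x y) (u - y) := by
    rcases eq_or_ne u y with rfl | hne
    · rw [sub_self, inner_zero_right] at hgap
      have : gapY Y L x u = 0 := le_antisymm hgap hgap0
      simp [this]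
    have hpos : 0 < ‖u - y‖ := norm_pos_iff.2 (sub_ne_zero.2 hne)
    -- For `u ≠ y` the stepsize is at least of order `√gap`, which improves the exponent from `2` to
    -- `3 / 2`.
    have hγ : min c₁ c₂ * r ≤ dualStep L Lyy y₀ 0 x y u := by
      refine le_min ?_ ?_
      · rw [add_zero, le_div_iff₀ (by positivity)]
        calc min c₁ c₂ * r * (Lyy * ‖u - y‖ ^ 2)
            ≤ c₁ * (κ * ‖gradY (regPayoff L y₀ 0) x y‖) * (Lyy * ‖u - y‖ ^ 2) := by
              gcongr; exact min_le_left _ _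
          _ = α / 4 * ‖u - y‖ ^ 2 * ‖gradY (regPayoff L y₀ 0) x y‖ := by
              rw [hc₁]; field_simp
          _ ≤ _ := hsc
      · exact (mul_le_mul_of_nonneg_right (min_le_right _ _) hr0).trans hrD
    calc min c₁ c₂ * (gapY Y L x y * r) = (min c₁ c₂ * r) * gapY Y L x y := by ring
      _ ≤ _ := mul_le_mul hγ hgap hgap0 h0
  simp only [gapY] at key ⊢
  linarith

end Regular

end Minimax

/-! ### Perturbation bounds and rates along a run. -/

namespace Minimax

variable {nx ny : ℕ} {X : Set (E nx)} {Y : Set (E ny)} {L : E nx → E ny → ℝ}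
  {μ Lxx Lyx Lyy : ℝ}

theorem exists_young_bound {p q c : ℝ} (hpq : p.HolderConjugate q) (hc : 0 < c) (B : ℝ) :
    ∃ A : ℝ, 0 < A ∧ ∀ τ h : ℝ, 0 ≤ τ → 0 ≤ h → B * τ * h ≤ c * h ^ p + A * τ ^ q := by
  have hp := hpq.pos
  have hq := hpq.symm.pos
  -- This scaling turns the first Young term `(κ * h) ^ p / p` into exactly `c * h ^ p`.
  set κ : ℝ := (p * c) ^ (1 / p) with hκ
  have hκ0 : 0 < κ := by positivity
  have hκp : κ ^ p = p * c := by
    rw [hκ, ← Real.rpow_mul (by positivity), one_div_mul_cancel hp.ne', Real.rpow_one]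
  refine ⟨((|B| + 1) / κ) ^ q / q, by positivity, fun τ h hτ hh => ?_⟩
  have hy := Real.young_inequality_of_nonneg (a := κ * h) (b := (|B| + 1) / κ * τ)
    (by positivity) (by positivity) hpq
  rw [Real.mul_rpow hκ0.le hh, Real.mul_rpow (by positivity) hτ, hκp] at hy
  calc B * τ * h ≤ (|B| + 1) * τ * h := by
        gcongr
        linarith [le_abs_self B]
    _ = κ * h * ((|B| + 1) / κ * τ) := by field_simp
    _ ≤ _ := hy
    _ = _ := by field_simp

namespace IsPOLMORun

variable {τ β : ℕ → ℝ} {x : ℕ → E nx} {y u : ℕ → E ny}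

theorem x_mem (hrun : IsPOLMORun X Y L Lyy τ β x y u) : ∀ t, x t ∈ X
  | 0 => hrun.x_zero
  | t + 1 => (hrun.x_succ t).1

theorem y_mem (hrun : IsPOLMORun X Y L Lyy τ β x y u) (hreg : Regular X Y L μ Lxx Lyx Lyy)
    (hβ : ∀ t, 0 ≤ β t) : ∀ t, y t ∈ Y
  | 0 => hrun.y_zero
  | t + 1 => by
    rw [hrun.y_succ]
    exact hreg.add_dualStep_smul_mem (hβ t) (hrun.y_mem hreg hβ t) (hrun.u_mem t)

end IsPOLMORun

namespace Regular

variable (hreg : Regular X Y L μ Lxx Lyx Lyy) (hcc : ConvexConcave X Y L)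
include hreg hcc

/-- Reduces each regime to three estimates: a dual decrease of order `p`, a perturbation `b t * gap
+ A * e t` from the primal step, and a Young inequality hiding the `b t` term in half of the dual
decrease. -/
theorem exists_run_rate {p s c A cτ Cτ : ℝ} (hp : 1 ≤ p) (hs : 0 ≤ s) (hc : 0 < c) (hA : 0 < A)
    (hcτ : 0 < cτ) (hCτ : 0 < Cτ) {τ β b e W : ℕ → ℝ}
    (hτ : ∀ t : ℕ, cτ * ((t : ℝ) + 1) ^ (-s) ≤ τ t ∧ τ t ≤ Cτ * ((t : ℝ) + 1) ^ (-s))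
    (he : ∀ t, 0 ≤ e t) (heW : ∀ T, ∑ t ∈ Finset.range (T + 1), e t ≤ A * W T)
    (hW1 : ∀ T, 1 ≤ W T) (hWT : ∀ T : ℕ, W T ≤ (T : ℝ) + 1)
    (hWs : ∀ T : ℕ, ((T : ℝ) + 1) ^ s ≤ ((T : ℝ) + 1) ^ (1 - 1 / p) * W T ^ (1 / p))
    (hβ : ∀ t, 0 ≤ β t) (hb : ∀ t, 0 ≤ b t) (hbA : ∀ t, b t ≤ A)
    (hdual : ∀ t, ∀ x ∈ X, ∀ y ∈ Y, ∀ y₀ ∈ Y, ∀ u,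
      IsLMO Y (-gradY (regPayoff L y₀ (β t)) x y) u →
      gapY Y L x (y + dualStep L Lyy y₀ (β t) x y u • (u - y)) ≤
        gapY Y L x y - c * gapY Y L x y ^ p + A * e t)
    (hpert : ∀ t, ∀ x ∈ X, ∀ x' ∈ X, ∀ y ∈ Y, ∀ w ∈ Y, primal Y L x' = L x' w →
      2 * Lxx * ‖x' - x‖ ^ 2 + 2 * Lyx * ‖x' - x‖ * ‖w - y‖ - ‖x' - x‖ ^ 2 / (2 * τ t) ≤
        b t * gapY Y L x y + A * e t)
    (hyoung : ∀ t h, 0 ≤ h → b t * h ≤ c / 2 * h ^ p + A * e t) :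
    ∃ K : ℝ, ∀ x y u, IsPOLMORun X Y L Lyy τ β x y u → ∀ T : ℕ,
      average (fun t => gapOpt X Y L (x t)) T ≤ K * W T ^ (1 / p) * ((T : ℝ) + 1) ^ (-(1 / p)) ∧
      average (fun t => gapY Y L (x t) (y t)) T ≤
        K * W T ^ (1 / p) * ((T : ℝ) + 1) ^ (-(1 / p)) := by
  obtain ⟨D, hD, hXD, -, -, hgapD⟩ := hreg.exists_bound hcc
  have hLxx := hreg.Lxx_nonneg
  have hLyx := hreg.Lyx_pos
  set C : ℝ := 1 + 3 * A + A * A + D + D ^ 2 with hC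
  have hC0 : 0 < C := by positivity
  obtain ⟨K, hK⟩ := exists_rate (c := c / 2) (C := C) hp hs (by positivity) hC0 hcτ hCτ hτ he
    (fun T => (heW T).trans (mul_le_mul_of_nonneg_right (by rw [hC]; nlinarith)
      (zero_le_one.trans (hW1 T)))) hW1 hWT hWs
  refine ⟨K, fun x y u hrun => ?_⟩
  have hx := hrun.x_mem
  have hy := hrun.y_mem hreg hβ
  obtain ⟨v, hv, hopt⟩ := hreg.exists_primal_minimizer hcc ⟨x 0, hx 0⟩ ⟨y 0, hy 0⟩
  have hτ0 : ∀ t, 0 < τ t := fun t => lt_of_lt_of_le (by positivity) (hτ t).1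
  refine hK _ _ (fun t => ‖x t - v‖ ^ 2) (fun t => (hopt _).2 (hx t))
    (fun t => hreg.gapY_nonneg (hx t) (hy t)) (fun t => by positivity) (fun t => ?_)
    ((hgapD _ (hx 0) _ (hy 0)).1.trans ?_) ((hgapD _ (hx 0) _ (hy 0)).2.trans ?_)
    (fun t => ?_) (fun t => ?_)
  · calc ‖x t - v‖ ^ 2 ≤ D ^ 2 := by gcongr; exact hXD _ (hx t) v hv
      _ ≤ C := by rw [hC]; nlinarith
  · rw [hC]; nlinarith
  · rw [hC]; nlinarith
  · obtain ⟨w, hw, hmax⟩ := hreg.exists_argmax (hx (t + 1)) ⟨y 0, hy 0⟩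
    have h1 := hreg.potential_step hcc (hτ0 t) (hx t) (hy t) (hy (t + 1)) hw hmax (hrun.x_succ t)
    have h2 := hdual t _ (hx t) _ (hy t) _ (hy 0) _ (hrun.u_mem t)
    rw [← hrun.y_succ] at h2
    -- `hpert` is applied at the old and the new dual point, each with weight one half; together
    -- they use `‖x (t + 1) - x t‖ ^ 2 / (2 * τ t)`, within the available gain.
    have h3 := hpert t _ (hx t) _ (hx (t + 1)) _ (hy t) _ hw hmax
    have h4 := hpert t _ (hx t) _ (hx (t + 1)) _ (hy (t + 1)) _ hw hmax
    have hg := hreg.gapY_nonneg (hx t) (hy t)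
    have h5 := hyoung t _ hg
    have h6 : b t * gapY Y L (x t) (y (t + 1)) ≤
        b t * gapY Y L (x t) (y t) + A * (A * e t) := by
      have hdec : gapY Y L (x t) (y (t + 1)) ≤ gapY Y L (x t) (y t) + A * e t := by
        have : 0 ≤ c * gapY Y L (x t) (y t) ^ p := by positivity
        linarith
      refine (mul_le_mul_of_nonneg_left hdec (hb t)).trans ?_
      rw [mul_add]
      have := he t
      gcongr
      exact hbA t
    have h7 : ‖x (t + 1) - x t‖ ^ 2 / (2 * τ t) ≤ ‖x (t + 1) - x t‖ ^ 2 / τ t := by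
      have := hτ0 t
      gcongr
      linarith
    have h8 : 0 ≤ (1 + D + D ^ 2) * e t := mul_nonneg (by positivity) (he t)
    have h9 : 0 ≤ A * A * e t := mul_nonneg (by positivity) (he t)
    have hCe : C * e t = (1 + D + D ^ 2) * e t + A * A * e t + 3 * A * e t := by rw [hC]; ring
    linarith
  · obtain ⟨w, hw, hmax⟩ := hreg.exists_argmax (hx (t + 1)) ⟨y 0, hy 0⟩
    have h1 := hreg.gapOpt_step hcc (hτ0 t) (hx t) (hy t) hw hmax hv (hrun.x_succ t)
    have h3 := hpert t _ (hx t) _ (hx (t + 1)) _ (hy t) _ hw hmax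
    have hg := hreg.gapY_nonneg (hx t) (hy t)
    have h4 : (1 + b t) * gapY Y L (x t) (y t) ≤ C * gapY Y L (x t) (y t) := by
      refine mul_le_mul_of_nonneg_right ?_ hg
      have := hbA t
      rw [hC]; nlinarith
    have h5 : A * e t ≤ C * e t := mul_le_mul_of_nonneg_right (by rw [hC]; nlinarith) (he t)
    have h6 : 0 ≤ Lyx * ‖x (t + 1) - x t‖ * ‖w - y t‖ := by positivity
    rw [(hopt _).1]
    linarith

theorem exists_pert_bound : ∃ A : ℝ, 0 < A ∧ ∀ τ : ℝ, 0 < τ →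
    ∀ x ∈ X, ∀ x' ∈ X, ∀ y ∈ Y, ∀ w ∈ Y,
      2 * Lxx * ‖x' - x‖ ^ 2 + 2 * Lyx * ‖x' - x‖ * ‖w - y‖ - ‖x' - x‖ ^ 2 / (2 * τ) ≤
        A * τ := by
  obtain ⟨D, hD, hX, hY, -, -⟩ := hreg.exists_bound hcc
  have hLxx := hreg.Lxx_nonneg
  have hLyx := hreg.Lyx_pos
  set B : ℝ := 2 * Lxx * D + 2 * Lyx * D with hB
  have hB0 : 0 < B := by positivity
  refine ⟨B ^ 2 / 2, by positivity, fun τ hτ x hx x' hx' y hy w hw => ?_⟩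
  have hd := hX x' hx' x hx
  set d := ‖x' - x‖
  have hd0 : 0 ≤ d := norm_nonneg _
  have h1 : 2 * Lxx * d ^ 2 + 2 * Lyx * d * ‖w - y‖ ≤ B * d := by
    calc _ ≤ 2 * Lxx * (d * D) + 2 * Lyx * d * D := by
          rw [sq]
          gcongr
          exact hY w hw y hy
      _ = _ := by rw [hB]; ring
  -- Completing the square gives the maximum over `d` of `B * d - d ^ 2 / (2 * τ)`.
  have h2 : B ^ 2 / 2 * τ + d ^ 2 / (2 * τ) - B * d = (d - B * τ) ^ 2 / (2 * τ) := by
    field_simp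
    ring
  have h3 : 0 ≤ (d - B * τ) ^ 2 / (2 * τ) := by positivity
  linarith

theorem exists_pert_bound_of_strongConcave (hμ : 0 < μ) {q : ℝ} (hq : 0 ≤ q) :
    ∃ A B : ℝ, 0 < A ∧ 0 < B ∧ ∀ τ : ℝ, 0 < τ →
    ∀ x ∈ X, ∀ x' ∈ X, ∀ y ∈ Y, ∀ w ∈ Y, primal Y L x' = L x' w →
      2 * Lxx * ‖x' - x‖ ^ 2 + 2 * Lyx * ‖x' - x‖ * ‖w - y‖ - ‖x' - x‖ ^ 2 / (2 * τ) ≤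
        B * τ * gapY Y L x y + A * τ ^ q := by
  obtain ⟨D, hD, hX, -, -, -⟩ := hreg.exists_bound hcc
  obtain ⟨C, hC, harg⟩ := hreg.exists_norm_argmax_sub_le hcc hμ
  have hLxx := hreg.Lxx_nonneg
  have hLyx := hreg.Lyx_pos
  set F : ℝ := 2 * Lxx + 2 * Lyx * C with hF
  have hF0 : 0 < F := by positivity
  refine ⟨F * D ^ 2 * (4 * F) ^ q, F ^ 2, by positivity, by positivity,
    fun τ hτ x hx x' hx' y hy w hw hmax => ?_⟩
  have hd := hX x' hx' x hx
  have hwy := harg x hx x' hx' y hy w hw hmax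
  have hrsq : √(gapY Y L x y) ^ 2 = gapY Y L x y := Real.sq_sqrt (hreg.gapY_nonneg hx hy)
  rw [← hrsq]
  have hr0 : 0 ≤ √(gapY Y L x y) := Real.sqrt_nonneg _
  set r := √(gapY Y L x y)
  set d := ‖x' - x‖
  have hd0 : 0 ≤ d := norm_nonneg _
  have h1 : 2 * Lxx * d ^ 2 + 2 * Lyx * d * ‖w - y‖ ≤ F * d ^ 2 + F * d * r := by
    calc _ ≤ 2 * Lxx * d ^ 2 + 2 * Lyx * d * (C * d + C * r) := by gcongr
      _ ≤ 2 * Lxx * d ^ 2 + 2 * Lyx * d * (C * d + C * r) + 2 * Lxx * d * r :=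
          le_add_of_nonneg_right (by positivity)
      _ = _ := by rw [hF]; ring
  have h2 : F ^ 2 * τ * r ^ 2 + d ^ 2 / (4 * τ) - F * d * r =
      (d - 2 * F * τ * r) ^ 2 / (4 * τ) := by
    field_simp
    ring
  have h3 : 0 ≤ (d - 2 * F * τ * r) ^ 2 / (4 * τ) := by positivity
  -- For `4 * F * τ ≤ 1` the left side is nonpositive. Larger stepsizes pay the bounded amount `F *
  -- D ^ 2`, and `(4 * F * τ) ^ q` is then at least `1`, so any `q ≥ 0` works.
  have h4 : F * d ^ 2 - d ^ 2 / (4 * τ) ≤ F * D ^ 2 * (4 * F) ^ q * τ ^ q := by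
    rw [mul_assoc, ← Real.mul_rpow (by positivity) hτ.le]
    rcases le_total (4 * F * τ) 1 with hle | hle
    · have e1 : F * d ^ 2 - d ^ 2 / (4 * τ) = (4 * F * τ - 1) * (d ^ 2 / (4 * τ)) := by
        field_simp
      have e2 : (4 * F * τ - 1) * (d ^ 2 / (4 * τ)) ≤ 0 :=
        mul_nonpos_of_nonpos_of_nonneg (by linarith) (by positivity)
      rw [e1]
      exact e2.trans (by positivity)
    · have e1 : F * d ^ 2 ≤ F * D ^ 2 := by gcongr
      have e2 : F * D ^ 2 * 1 ≤ F * D ^ 2 * (4 * F * τ) ^ q := by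
        gcongr
        exact Real.one_le_rpow hle hq
      have e3 : 0 ≤ d ^ 2 / (4 * τ) := by positivity
      linarith
  have h5 : d ^ 2 / (2 * τ) = d ^ 2 / (4 * τ) + d ^ 2 / (4 * τ) := by field_simp; ring
  linarith

/-- Convergence of the smoothed method. -/
theorem exists_rate_of_concave {τ β : ℕ → ℝ} (hτ0 : ∀ t, 0 < τ t) (hβ0 : ∀ t, 0 < β t)
    (hτ : τ =Θ[atTop] (fun t : ℕ => (t : ℝ) ^ (-(2 / 3) : ℝ)))
    (hβ : β =Θ[atTop] (fun t : ℕ => (t : ℝ) ^ (-(1 / 3) : ℝ))) :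
    ∃ K : ℝ, ∀ x y u, IsPOLMORun X Y L Lyy τ β x y u → ∀ T : ℕ,
      average (fun t => gapOpt X Y L (x t)) T ≤ K * ((T : ℝ) + 1) ^ (-(1 / 3) : ℝ) ∧
      average (fun t => gapY Y L (x t) (y t)) T ≤ K * ((T : ℝ) + 1) ^ (-(1 / 3) : ℝ) := by
  obtain ⟨cτ, Cτ, hcτ, hCτ, hτb⟩ := exists_bounds_of_isTheta hτ0 hτ
  obtain ⟨cβ, Cβ, hcβ, hCβ, hβb⟩ := exists_bounds_of_isTheta hβ0 hβ
  obtain ⟨A, hA, hpert⟩ := hreg.exists_pert_bound hcc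
  have hone : ∀ T : ℕ, (1 : ℝ) ≤ (T : ℝ) + 1 := fun T => by
    linarith [Nat.cast_nonneg (α := ℝ) T]
  have hpos : ∀ T : ℕ, (0 : ℝ) < (T : ℝ) + 1 := fun T => by positivity
  rcases hreg.Lyy_nonneg.eq_or_lt with hL | hL
  -- Here `p = 1` and the error `τ + β` sums to order `T ^ (2/3)`.
  · obtain ⟨C, hC, hdual⟩ := hreg.exists_gapY_linear_decrease hcc hL.symm
    have hsum : ∀ T, ∑ t ∈ Finset.range (T + 1), (τ t + β t) ≤
        (A + C + (Cτ + Cβ) / (1 - 1 / 3)) * ((T : ℝ) + 1) ^ (2 / 3 : ℝ) := fun T => by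
      calc _ ≤ ∑ t ∈ Finset.range (T + 1), (Cτ + Cβ) * ((t : ℝ) + 1) ^ (-(1 / 3) : ℝ) := by
            refine Finset.sum_le_sum fun t _ => ?_
            have := mul_le_mul_of_nonneg_left (Real.rpow_le_rpow_of_exponent_le (hone t)
              (by norm_num : (-(2 / 3) : ℝ) ≤ -(1 / 3))) hCτ.le
            linarith [(hτb t).2, (hβb t).2]
        _ ≤ (Cτ + Cβ) * (((T : ℝ) + 1) ^ (1 - 1 / 3 : ℝ) / (1 - 1 / 3)) := by
            rw [← Finset.mul_sum]
            gcongr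
            exact_mod_cast sum_rpow_neg_le (a := 1 / 3) (by norm_num) (by norm_num) (T + 1)
        _ = (Cτ + Cβ) / (1 - 1 / 3) * ((T : ℝ) + 1) ^ (2 / 3 : ℝ) := by
            rw [show (1 - 1 / 3 : ℝ) = 2 / 3 by norm_num]; ring
        _ ≤ _ := by gcongr; linarith
    obtain ⟨K, hK⟩ := hreg.exists_run_rate hcc (p := 1) (s := 2 / 3) (c := 1 / 4)
      (A := A + C + (Cτ + Cβ) / (1 - 1 / 3)) (b := fun _ => 0) (e := fun t => τ t + β t)
      (W := fun T => ((T : ℝ) + 1) ^ (2 / 3 : ℝ)) (β := β) le_rfl (by norm_num) (by norm_num)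
      (by norm_num; positivity) hcτ hCτ hτb (fun t => (add_pos (hτ0 t) (hβ0 t)).le) hsum
      (fun T => Real.one_le_rpow (hone T) (by norm_num))
      (fun T => by
        simpa using Real.rpow_le_rpow_of_exponent_le (hone T) (by norm_num : (2 / 3 : ℝ) ≤ 1))
      (fun T => by simp) (fun t => (hβ0 t).le) (fun t => le_rfl)
      (fun t => by norm_num; positivity)
      (fun t x hx y hy y₀ hy₀ u hu => by
        rw [Real.rpow_one]
        refine (hdual x hx y hy y₀ hy₀ _ u (hβ0 t) hu).trans ?_
        have h1 := hτ0 t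
        have h2 := hβ0 t
        gcongr
        · rw [add_right_comm]
          exact le_add_of_nonneg_left (by norm_num; positivity)
        · exact le_add_of_nonneg_left h1.le)
      (fun t x hx x' hx' y hy w hw _ => by
        refine (hpert _ (hτ0 t) x hx x' hx' y hy w hw).trans ?_
        have h1 := hτ0 t
        have h2 := hβ0 t
        rw [zero_mul, zero_add]
        gcongr
        · rw [add_assoc]
          exact le_add_of_nonneg_right (by norm_num; positivity)
        · exact le_add_of_nonneg_right h2.le)
      (fun t h hh => by
        have h1 := hτ0 t
        have h2 := hβ0 t
        rw [zero_mul]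
        norm_num
        positivity)
    refine ⟨K, fun x y u hrun T => ?_⟩
    have h := hK x y u hrun T
    rw [mul_assoc, ← Real.rpow_mul (hpos T).le, ← Real.rpow_add (hpos T)] at h
    norm_num at h ⊢
    exact h
  -- Here `p = 2` and the error `τ + β ^ 2` sums to order `T ^ (1/3)`; the rate exponent is `1/6 -
  -- 1/2 = -1/3`.
  · obtain ⟨c, C, hc, hC, hdual⟩ := hreg.exists_gapY_sq_decrease hcc hL hCβ.le
    have hβC : ∀ t, β t ≤ Cβ := fun t => by
      refine (hβb t).2.trans (mul_le_of_le_one_right hCβ.le ?_)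
      exact Real.rpow_le_one_of_one_le_of_nonpos (hone t) (by norm_num)
    have hsum : ∀ T, ∑ t ∈ Finset.range (T + 1), (τ t + β t ^ 2) ≤
        (A + C + (Cτ + Cβ ^ 2) / (1 - 2 / 3)) * ((T : ℝ) + 1) ^ (1 / 3 : ℝ) := fun T => by
      calc _ ≤ ∑ t ∈ Finset.range (T + 1), (Cτ + Cβ ^ 2) * ((t : ℝ) + 1) ^ (-(2 / 3) : ℝ) := by
            refine Finset.sum_le_sum fun t _ => ?_
            have h1 := pow_le_pow_left₀ (hβ0 t).le (hβb t).2 2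
            rw [mul_pow, ← Real.rpow_natCast, ← Real.rpow_natCast, ← Real.rpow_natCast,
              ← Real.rpow_mul (hpos t).le,
              show (-(1 / 3) * ((2 : ℕ) : ℝ) : ℝ) = -(2 / 3) by norm_num] at h1
            rw [← Real.rpow_natCast, ← Real.rpow_natCast]
            linarith [(hτb t).2]
        _ ≤ (Cτ + Cβ ^ 2) * (((T : ℝ) + 1) ^ (1 - 2 / 3 : ℝ) / (1 - 2 / 3)) := by
            rw [← Finset.mul_sum]
            gcongr
            exact_mod_cast sum_rpow_neg_le (a := 2 / 3) (by norm_num) (by norm_num) (T + 1)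
        _ = (Cτ + Cβ ^ 2) / (1 - 2 / 3) * ((T : ℝ) + 1) ^ (1 / 3 : ℝ) := by
            rw [show (1 - 2 / 3 : ℝ) = 1 / 3 by norm_num]; ring
        _ ≤ _ := by gcongr; linarith
    obtain ⟨K, hK⟩ := hreg.exists_run_rate hcc (p := 2) (s := 2 / 3) (c := c)
      (A := A + C + (Cτ + Cβ ^ 2) / (1 - 2 / 3)) (b := fun _ => 0) (e := fun t => τ t + β t ^ 2)
      (W := fun T => ((T : ℝ) + 1) ^ (1 / 3 : ℝ)) (β := β) (by norm_num) (by norm_num) hc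
      (by norm_num; positivity) hcτ hCτ hτb
      (fun t => (add_pos (hτ0 t) (pow_pos (hβ0 t) 2)).le) hsum
      (fun T => Real.one_le_rpow (hone T) (by norm_num))
      (fun T => by
        simpa using Real.rpow_le_rpow_of_exponent_le (hone T) (by norm_num : (1 / 3 : ℝ) ≤ 1))
      (fun T => by
        rw [← Real.rpow_mul (hpos T).le, ← Real.rpow_add (hpos T)]
        norm_num)
      (fun t => (hβ0 t).le) (fun t => le_rfl)
      (fun t => by norm_num; positivity)
      (fun t x hx y hy y₀ hy₀ u hu => by
        rw [Real.rpow_two]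
        refine (hdual x hx y hy y₀ hy₀ _ u (hβ0 t).le (hβC t) hu).trans ?_
        have h1 := hτ0 t
        have h2 := hβ0 t
        gcongr
        · rw [add_right_comm]
          exact le_add_of_nonneg_left (by norm_num; positivity)
        · exact le_add_of_nonneg_left h1.le)
      (fun t x hx x' hx' y hy w hw _ => by
        refine (hpert _ (hτ0 t) x hx x' hx' y hy w hw).trans ?_
        have h1 := hτ0 t
        have h2 := hβ0 t
        rw [zero_mul, zero_add]
        gcongr
        · rw [add_assoc]
          exact le_add_of_nonneg_right (by norm_num; positivity)
        · exact le_add_of_nonneg_right (by positivity))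
      (fun t h hh => by
        have h1 := hτ0 t
        have h2 := hβ0 t
        rw [zero_mul]
        norm_num
        positivity)
    refine ⟨K, fun x y u hrun T => ?_⟩
    have h := hK x y u hrun T
    rw [mul_assoc, ← Real.rpow_mul (hpos T).le, ← Real.rpow_add (hpos T)] at h
    norm_num at h ⊢
    exact h

/-- Convergence of the unsmoothed method under strong concavity, when a dual step decreases the dual
gap by a multiple of its `p`-th power. -/
theorem exists_rate_of_strongConcave (hμ : 0 < μ) {p q c : ℝ} (hpq : p.HolderConjugate q)
    (hc : 0 < c) {τ : ℕ → ℝ} (hτ0 : ∀ t, 0 < τ t)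
    (hτ : τ =Θ[atTop] (fun t : ℕ => (t : ℝ) ^ (-(1 / q) : ℝ)))
    (hdual : ∀ x ∈ X, ∀ y ∈ Y, ∀ y₀ ∈ Y, ∀ u,
      IsLMO Y (-gradY (regPayoff L y₀ 0) x y) u →
      gapY Y L x (y + dualStep L Lyy y₀ 0 x y u • (u - y)) ≤
        gapY Y L x y - c * gapY Y L x y ^ p) :
    ∃ K : ℝ, ∀ x y u, IsPOLMORun X Y L Lyy τ (fun _ => 0) x y u → ∀ T : ℕ,
      average (fun t => gapOpt X Y L (x t)) T ≤
        K * (1 + Real.log ((T : ℝ) + 1)) ^ (1 / p) * ((T : ℝ) + 1) ^ (-(1 / p)) ∧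
      average (fun t => gapY Y L (x t) (y t)) T ≤
        K * (1 + Real.log ((T : ℝ) + 1)) ^ (1 / p) * ((T : ℝ) + 1) ^ (-(1 / p)) := by
  have hq := hpq.symm.pos
  have hp := hpq.pos
  obtain ⟨cτ, Cτ, hcτ, hCτ, hτb⟩ := exists_bounds_of_isTheta hτ0 hτ
  obtain ⟨A₁, B, hA₁, hB, hpert⟩ := hreg.exists_pert_bound_of_strongConcave hcc hμ hq.le
  obtain ⟨A₂, hA₂, hyoung⟩ := exists_young_bound hpq (half_pos hc) B
  have hone : ∀ T : ℕ, (1 : ℝ) ≤ (T : ℝ) + 1 := fun T => by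
    linarith [Nat.cast_nonneg (α := ℝ) T]
  have hlog : ∀ T : ℕ, 0 ≤ Real.log ((T : ℝ) + 1) := fun T => Real.log_nonneg (hone T)
  have hτC : ∀ t, τ t ≤ Cτ := fun t => by
    refine (hτb t).2.trans (mul_le_of_le_one_right hCτ.le ?_)
    exact Real.rpow_le_one_of_one_le_of_nonpos (hone t)
      (by have : 0 < 1 / q := by positivity
          linarith)
  have hCq : 0 < Cτ ^ q := by positivity
  have hBC : 0 < B * Cτ := by positivity
  -- Stepsizes of order `t ^ (-1/q)` make `τ t ^ q` harmonic, which is the source of the logarithm.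
  have hsum : ∀ T, ∑ t ∈ Finset.range (T + 1), τ t ^ q ≤
      (A₁ + A₂ + B * Cτ + Cτ ^ q) * (1 + Real.log ((T : ℝ) + 1)) := fun T => by
    calc _ ≤ ∑ t ∈ Finset.range (T + 1), Cτ ^ q * ((t : ℝ) + 1) ^ (-1 : ℝ) := by
          refine Finset.sum_le_sum fun t _ => ?_
          have h1 := Real.rpow_le_rpow (hτ0 t).le (hτb t).2 hq.le
          rwa [Real.mul_rpow hCτ.le (by positivity), ← Real.rpow_mul (by positivity),
            neg_mul, one_div_mul_cancel hq.ne'] at h1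
      _ ≤ Cτ ^ q * (1 + Real.log ((T : ℝ) + 1)) := by
          rw [← Finset.mul_sum]
          gcongr
          exact_mod_cast sum_inv_le_one_add_log (T + 1)
      _ ≤ _ := by
          have := hlog T
          gcongr
          linarith
  have hexp : 1 - 1 / p = 1 / q := by
    have := hpq.inv_add_inv_eq_one
    rw [one_div, one_div]
    linarith
  refine hreg.exists_run_rate hcc (p := p) (s := 1 / q) (c := c)
    (A := A₁ + A₂ + B * Cτ + Cτ ^ q) (b := fun t => B * τ t) (e := fun t => τ t ^ q)
    (W := fun T => 1 + Real.log ((T : ℝ) + 1)) hpq.lt.le (by positivity) hc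
    (by positivity) hcτ hCτ hτb (fun t => (Real.rpow_pos_of_pos (hτ0 t) q).le) hsum
    (fun T => by linarith [hlog T])
    (fun T => by linarith [Real.log_le_sub_one_of_pos (zero_lt_one.trans_le (hone T))])
    (fun T => ?_) (fun t => le_rfl) (fun t => (mul_pos hB (hτ0 t)).le)
    (fun t => by
      have := mul_le_mul_of_nonneg_left (hτC t) hB.le
      linarith)
    (fun t x hx y hy y₀ hy₀ u hu => ?_)
    (fun t x hx x' hx' y hy w hw hmax => ?_)
    (fun t h hh => ?_)
  · rw [hexp]
    refine le_mul_of_one_le_right (by positivity) (Real.one_le_rpow ?_ (by positivity))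
    linarith [hlog T]
  · have := Real.rpow_pos_of_pos (hτ0 t) q
    refine (hdual x hx y hy y₀ hy₀ u hu).trans (le_add_of_nonneg_right (by positivity))
  · have := Real.rpow_pos_of_pos (hτ0 t) q
    refine (hpert _ (hτ0 t) x hx x' hx' y hy w hw hmax).trans ?_
    gcongr
    linarith
  · have := Real.rpow_pos_of_pos (hτ0 t) q
    refine (hyoung _ _ (hτ0 t).le hh).trans ?_
    gcongr
    linarith

theorem gapY_eq_zero_of_Lyy_eq_zero (hμ : 0 < μ) (hL : Lyy = 0) {x : E nx} {y : E ny}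
    (hx : x ∈ X) (hy : y ∈ Y) : gapY Y L x y = 0 := by
  obtain ⟨w, hw, hmax⟩ := hreg.exists_argmax hx ⟨y, hy⟩
  rw [gapY, hmax, hreg.subsingleton_of_Lyy_eq_zero hcc hμ ⟨x, hx⟩ hL hw hy, sub_self]

end Regular

end Minimax

/-! ### Choice of the exponents in the three regimes. -/

theorem theorem6 {nx ny : ℕ} (X : Set (Minimax.E nx)) (Y : Set (Minimax.E ny))
    (L : Minimax.E nx → Minimax.E ny → ℝ) (μ Lxx Lyx Lyy : ℝ)
    (hreg : Minimax.Regular X Y L μ Lxx Lyx Lyy)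
    (hcc : Minimax.ConvexConcave X Y L) :
    -- convex-concave
    (∀ τ β : ℕ → ℝ, (∀ t, 0 < τ t) → (∀ t, 0 < β t) →
      τ =Θ[atTop] (fun t : ℕ => (t : ℝ) ^ (-(2 / 3) : ℝ)) →
      β =Θ[atTop] (fun t : ℕ => (t : ℝ) ^ (-(1 / 3) : ℝ)) →
      ∃ K : ℝ, ∀ x y u, Minimax.IsPOLMORun X Y L Lyy τ β x y u → ∀ T : ℕ,
        Minimax.average (fun t => Minimax.gapOpt X Y L (x t)) T
            ≤ K * ((T : ℝ) + 1) ^ (-(1 / 3) : ℝ) ∧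
        Minimax.average (fun t => Minimax.gapY Y L (x t) (y t)) T
            ≤ K * ((T : ℝ) + 1) ^ (-(1 / 3) : ℝ)) ∧
    -- convex-strongly concave
    (0 < μ → ∀ τ : ℕ → ℝ, (∀ t, 0 < τ t) →
      τ =Θ[atTop] (fun t : ℕ => (t : ℝ) ^ (-(1 / 2) : ℝ)) →
      ∃ K : ℝ, ∀ x y u, Minimax.IsPOLMORun X Y L Lyy τ (fun _ => 0) x y u → ∀ T : ℕ,
        Minimax.average (fun t => Minimax.gapOpt X Y L (x t)) T
            ≤ K * (1 + Real.log ((T : ℝ) + 1)) ^ (1 / 2 : ℝ) * ((T : ℝ) + 1) ^ (-(1 / 2) : ℝ) ∧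
        Minimax.average (fun t => Minimax.gapY Y L (x t) (y t)) T
            ≤ K * (1 + Real.log ((T : ℝ) + 1)) ^ (1 / 2 : ℝ) * ((T : ℝ) + 1) ^ (-(1 / 2) : ℝ)) ∧
    -- convex-strongly concave with a strongly convex dual feasible set
    (0 < μ → ∀ α : ℝ, 0 < α → Minimax.StronglyConvexSet α Y →
      ∀ τ : ℕ → ℝ, (∀ t, 0 < τ t) →
      τ =Θ[atTop] (fun t : ℕ => (t : ℝ) ^ (-(1 / 3) : ℝ)) →
      ∃ K : ℝ, ∀ x y u, Minimax.IsPOLMORun X Y L Lyy τ (fun _ => 0) x y u → ∀ T : ℕ,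
        Minimax.average (fun t => Minimax.gapOpt X Y L (x t)) T
            ≤ K * (1 + Real.log ((T : ℝ) + 1)) ^ (2 / 3 : ℝ) * ((T : ℝ) + 1) ^ (-(2 / 3) : ℝ) ∧
        Minimax.average (fun t => Minimax.gapY Y L (x t) (y t)) T
            ≤ K * (1 + Real.log ((T : ℝ) + 1)) ^ (2 / 3 : ℝ) * ((T : ℝ) + 1) ^ (-(2 / 3) : ℝ)) := by
  refine ⟨fun τ β hτ0 hβ0 hτ hβ => hreg.exists_rate_of_concave hcc hτ0 hβ0 hτ hβ,
    fun hμ τ hτ0 hτ => ?_, fun hμ α hα hS τ hτ0 hτ => ?_⟩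
  · have hdual : ∃ c : ℝ, 0 < c ∧ ∀ x ∈ X, ∀ y ∈ Y, ∀ y₀ ∈ Y, ∀ u,
        Minimax.IsLMO Y (-Minimax.gradY (Minimax.regPayoff L y₀ 0) x y) u →
        Minimax.gapY Y L x (y + Minimax.dualStep L Lyy y₀ 0 x y u • (u - y)) ≤
          Minimax.gapY Y L x y - c * Minimax.gapY Y L x y ^ (2 : ℝ) := by
      rcases hreg.Lyy_nonneg.eq_or_lt with hL | hL
      -- When `Lyy = 0` all dual gaps vanish, so any positive constant serves.
      · refine ⟨1, one_pos, fun x hx y hy y₀ hy₀ u hu => ?_⟩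
        rw [hreg.gapY_eq_zero_of_Lyy_eq_zero hcc hμ hL.symm hx hy,
          hreg.gapY_eq_zero_of_Lyy_eq_zero hcc hμ hL.symm hx
            (hreg.add_dualStep_smul_mem le_rfl hy hu)]
        simp
      · obtain ⟨c, C, hc, -, h⟩ := hreg.exists_gapY_sq_decrease hcc hL le_rfl
        refine ⟨c, hc, fun x hx y hy y₀ hy₀ u hu => ?_⟩
        rw [Real.rpow_two]
        simpa using h x hx y hy y₀ hy₀ 0 u le_rfl le_rfl hu
    obtain ⟨c, hc, hdual⟩ := hdual
    exact hreg.exists_rate_of_strongConcave hcc hμ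
      (Real.holderConjugate_iff.2 ⟨by norm_num, by norm_num⟩) hc hτ0 hτ hdual
  · have hdual : ∃ c : ℝ, 0 < c ∧ ∀ x ∈ X, ∀ y ∈ Y, ∀ y₀ ∈ Y, ∀ u,
        Minimax.IsLMO Y (-Minimax.gradY (Minimax.regPayoff L y₀ 0) x y) u →
        Minimax.gapY Y L x (y + Minimax.dualStep L Lyy y₀ 0 x y u • (u - y)) ≤
          Minimax.gapY Y L x y - c * Minimax.gapY Y L x y ^ (3 / 2 : ℝ) := by
      rcases hreg.Lyy_nonneg.eq_or_lt with hL | hL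
      · refine ⟨1, one_pos, fun x hx y hy y₀ hy₀ u hu => ?_⟩
        rw [hreg.gapY_eq_zero_of_Lyy_eq_zero hcc hμ hL.symm hx hy,
          hreg.gapY_eq_zero_of_Lyy_eq_zero hcc hμ hL.symm hx
            (hreg.add_dualStep_smul_mem le_rfl hy hu)]
        rw [Real.zero_rpow (by norm_num)]
        simp
      · obtain ⟨c, hc, h⟩ := hreg.exists_gapY_rpow_decrease hcc hμ hL hα hS
        refine ⟨c, hc, fun x hx y hy y₀ hy₀ u hu => ?_⟩
        rw [show (3 / 2 : ℝ) = 1 + 1 / 2 by norm_num,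
          Real.rpow_add_of_nonneg (hreg.gapY_nonneg hx hy) (by norm_num) (by norm_num),
          Real.rpow_one, ← Real.sqrt_eq_rpow]
        exact h x hx y hy y₀ hy₀ u hu
    obtain ⟨c, hc, hdual⟩ := hdual
    -- The dual decrease exponent `3 / 2` has conjugate `3`, which dictates the stepsize order `t ^
    -- (-1/3)`.
    have h := hreg.exists_rate_of_strongConcave hcc hμ (p := 3 / 2) (q := 3)
      (Real.holderConjugate_iff.2 ⟨by norm_num, by norm_num⟩) hc hτ0 hτ hdual
    rwa [show (1 / (3 / 2) : ℝ) = 2 / 3 by norm_num] at h
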